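/- **Setting.** A weighted oriented graph $D=(G,\mathcal O,w)$ consists of a finite simple graph $G$, an orientation $\mathcal O$ of its edges (each edge gets exactly one of its two directions; $E(D)$ is the set of oriented edges), and a weight function $w:V(G)\to\{1,2,3,\dots\}$. Put $V^+=\{x : w(x)>1\}$, $N_D^+(x)=\{y:(x,y)\in E(D)\}$, $N_D^-(x)=\{y:(y,x)\in E(D)\}$, $N_D(x)=N_D^+(x)\cup N_D^-(x)$, $N_D^+(A)=\bigcup_{x\in A}N_D^+(x)$. It is assumed throughout that $w(x)=1$ whenever $x$ is a source, i.e. $N_D^-(x)=\emptyset$. For a field $K$, the edge ideal is $I(D)=(x\,y^{w(y)} : (x,y)\in E(D))$ in the polynomial ring over $K$ whose variables are the vertices. An ideal is unmixed if all its associated primes have the same height. **SCQ graphs.** A simplex of $G$ is a complete induced subgraph of the form $G[N_G[v]]$, where $N_G[v]$ is the closed neighbourhood of a vertex $v$; $S_G$ is the set of simplexes. A basic $5$-cycle is an induced $5$-cycle of $G$ that does not contain two adjacent vertices of degree at least three in $G$; $C_G$ is the set of basic $5$-cycles. An edge $e$ has property (P) if, whenever $e=\{b,b'\}$ and $\{a,b\},\{a',b'\}\in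 E(G)$, then $\{a,a'\}\in E(G)$ (in particular $a\neq a'$). $G$ is an SCQ graph if there is a (possibly empty) set $Q_G$ of pairwise disjoint edges, each with property (P), such that $\{V(H) : H\in S_G\cup C_G\cup Q_G\}$ is a partition of $V(G)$. **The $\star$-property.** An induced $5$-cycle $C$ has the $\star$-property if for every oriented edge $(a,b)$ of $C$ with $a\in V^+$, writing $C=(a',a,b,b',c,a')$, one has: $(\star.1)$ $(a',a)\in E(D)$ and $w(a')=1$; $(\star.2)$ $N_D^-(a)\subseteq N_D(c)$ and $N_D^-(a)\cap V^+\subseteq N_D^-(c)$; $(\star.3)$ $N_D(b')\subseteq N_D(a')\cup N_D^+(a)$ and $N_D^-(b')\cap V^+\subseteq N_D^-(a')$. **$\star$-semi-forests.** Subgraphs of $D$ carry the orientation and the weights of $D$. A root oriented tree with parent $v$ is a subgraph $T$ of $D$ without cycles, with $v\in V(T)$, such that for each $x\in V(T)\setminus\{v\}$ there is an oriented path in $T$ from $v$ to $x$, and such that each $x\in V(T)$ with $w(x)=1$ satisfies either $\deg_T(x)=1$ and $x\ne v$, or $V(T)=\{v\}$ and $x=v$. A unicycle oriented subgraph is a subgraph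 $B$ of $D$ with exactly one cycle $C$, such that $C$ is an oriented cycle, for each $y\in V(B)\setminus V(C)$ there is an oriented path in $B$ from a vertex of $C$ to $y$, and each $x\in V(B)$ with $w(x)=1$ has $\deg_B(x)=1$. A $\star$-semi-forest is a subgraph $H$ of $D$ that is a union $T_1\cup\dots\cup T_r\cup B_1\cup\dots\cup B_s$ ($r,s\ge 0$) of root oriented trees $T_i$ with parents $v_i$ and unicycle oriented subgraphs $B_j$, such that: (i) $V(T_1),\dots,V(T_r),V(B_1),\dots,V(B_s)$ is a partition of $V(H)$; (ii) there are (not necessarily distinct) $w_1,\dots,w_r\in V(D)\setminus V(H)$ with $w_i\in N_D(v_i)$; (iii) $W=\{w_1,\dots,w_r\}$ is a disjoint union $W_1\cup W_2$ (either set possibly empty) where $W_1$ contains no two adjacent vertices, $W_2\subseteq V^+$, $(w_i,v_i)\in E(D)$ whenever $w_i\in W_2$, and $N_D^+(W_2\cup\tilde H)\cap W_1=\emptyset$ with $\tilde H=\{x\in V(H):\deg_H(x)\ge 2\}\cup\{v_i:\deg_H(v_i)=1\}$. A subgraph $L$ of $D$ has a generating $\star$-semi-forest if there is a $\star$-semi-forest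 $H$ of $D$ with $V(H)=V(L)$. **Theorem.** Let $D=(G,\mathcal O,w)$ be a weighted oriented graph, all of whose sources have weight one, whose underlying graph $G$ is an SCQ graph, with $Q_G$ as above, and let $K$ be a field. Then $I(D)$ is unmixed if and only if the following three conditions hold: (a) each basic $5$-cycle of $G$ has the $\star$-property; (b) no simplex of $D$ has a generating $\star$-semi-forest; (c) $N_D(b)\subseteq N_D^+(a)$ whenever $a\in V^+$, $\{b,b'\}\in Q_G$ and $b'\in N_D^+(a)$. -/

import Mathlib

/-- An ideal is unmixed if all its associated primes have the same height. -/
def IdealIsUnmixed {R : Type*} [CommRing R] (I : Ideal R) : Prop :=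
  ∀ p ∈ associatedPrimes R (R ⧸ I), ∀ q ∈ associatedPrimes R (R ⧸ I), p.height = q.height

/-! ### SCQ graphs -/

namespace SCQ

variable {V : Type*} (G : SimpleGraph V)

/-- The closed neighbourhood `N_G[v]`. -/
def closedNbr (v : V) : Set V := insert v (G.neighborSet v)

/-- The degree of a vertex (the vertex set is finite in all uses). -/
noncomputable def deg (v : V) : ℕ := (G.neighborSet v).ncard

/-- The simplexes of `G`: the sets `N_G[v]` that induce a complete graph. A simplex is an induced
subgraph, so it is given by its vertex set. -/
def simplexes : Set (Set V) := {A | ∃ v, A = closedNbr G v ∧ G.IsClique A}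

/-- An induced 5-cycle `(z 0, z 1, z 2, z 3, z 4, z 0)` of `G` is a graph embedding `z` of the cycle
graph on five vertices. It is basic if it does not contain two adjacent vertices that both have
degree at least three in `G`. -/
def IsBasic (z : SimpleGraph.cycleGraph 5 ↪g G) : Prop :=
  ∀ i j, G.Adj (z i) (z j) → ¬ (3 ≤ deg G (z i) ∧ 3 ≤ deg G (z j))

/-- The basic 5-cycles of `G`; being induced subgraphs, they are given by their vertex sets. -/
def basicFiveCycles : Set (Set V) :=
  {A | ∃ z : SimpleGraph.cycleGraph 5 ↪g G, IsBasic G z ∧ Set.range z = A}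

/-- A set of pairwise disjoint edges. -/
def IsMatching (Q : Set (Sym2 V)) : Prop :=
  Q ⊆ G.edgeSet ∧ ∀ e ∈ Q, ∀ f ∈ Q, e ≠ f → ∀ x, ¬ (x ∈ e ∧ x ∈ f)

/-- Property (P) of an edge `e = {b, b'}`: for all edges `{a, b}` and `{a', b'}` of `G`, also
`{a, a'}` is an edge of `G` (in particular `a ≠ a'`). -/
def PropertyP (e : Sym2 V) : Prop :=
  ∀ a b a' b', e = s(b, b') → G.Adj a b → G.Adj a' b' → G.Adj a a'

/-- `G` is an SCQ graph, `Q` being the matching `Q_G`. -/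
structure IsSCQ (Q : Set (Sym2 V)) : Prop where
  matching : IsMatching G Q
  propertyP : ∀ e ∈ Q, PropertyP G e
  partition : Setoid.IsPartition
    (simplexes G ∪ basicFiveCycles G ∪ {A : Set V | ∃ e ∈ Q, A = {x | x ∈ e}})

end SCQ

/-! ### Weighted oriented graphs -/

/-- A weighted oriented graph `D = (G, O, w)` with vertex set `V`: a simple graph in which every edge
is given exactly one of its two directions, and a positive integer weight on every vertex. -/
structure WOGraph (V : Type*) where
  graph : SimpleGraph V
  arc : V → V → Prop
  adj_iff : ∀ x y, graph.Adj x y ↔ arc x y ∨ arc y x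
  asymm : ∀ x y, arc x y → ¬ arc y x
  weight : V → ℕ
  weight_pos : ∀ x, 1 ≤ weight x

namespace WOGraph

variable {V : Type*} (D : WOGraph V)

/-- The out-neighbourhood `N_D^+(x)`. -/
def outNbr (x : V) : Set V := {y | D.arc x y}

/-- The in-neighbourhood `N_D^-(x)`. -/
def inNbr (x : V) : Set V := {y | D.arc y x}

/-- The neighbourhood `N_D(x)`. -/
def nbr (x : V) : Set V := D.outNbr x ∪ D.inNbr x

/-- The set `V^+` of the vertices of weight greater than one. -/
def plus : Set V := {x | 1 < D.weight x}

/-- A source has no in-neighbours. -/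
def IsSource (x : V) : Prop := D.inNbr x = ∅

/-- The edge ideal `I(D)`, generated by `x_i x_j ^ w(x_j)` for the oriented edges `(x_i, x_j)`. -/
noncomputable def edgeIdeal (K : Type*) [Field K] : Ideal (MvPolynomial V K) :=
  Ideal.span {f | ∃ x y, D.arc x y ∧
    f = MvPolynomial.X x * MvPolynomial.X y ^ D.weight y}

/-- The ⋆-property of an induced 5-cycle with vertex set `A`. The `z` that are quantified over are
the labellings `(a', a, b, b', c, a')` of the cycle, with `a' = z 0`, `a = z 1`, `b = z 2`,
`b' = z 3`, `c = z 4`; the labelling is determined by the edge `(a, b)`. -/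
def HasStarProperty (A : Set V) : Prop :=
  ∀ z : SimpleGraph.cycleGraph 5 ↪g D.graph, Set.range z = A →
    D.arc (z 1) (z 2) → z 1 ∈ D.plus →
      (D.arc (z 0) (z 1) ∧ D.weight (z 0) = 1) ∧
      (D.inNbr (z 1) ⊆ D.nbr (z 4) ∧ D.inNbr (z 1) ∩ D.plus ⊆ D.inNbr (z 4)) ∧
      (D.nbr (z 3) ⊆ D.nbr (z 0) ∪ D.outNbr (z 1) ∧
        D.inNbr (z 3) ∩ D.plus ⊆ D.inNbr (z 0))

/-- A weighted oriented subgraph of `D`; its weights are those of `D`. -/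
structure Sub where
  verts : Set V
  arc : V → V → Prop
  arc_le : ∀ x y, arc x y → D.arc x y
  left_mem : ∀ x y, arc x y → x ∈ verts
  right_mem : ∀ x y, arc x y → y ∈ verts

/-- The weighted oriented subgraph of `D` induced by a set of vertices. -/
def induce (A : Set V) : D.Sub where
  verts := A
  arc x y := D.arc x y ∧ x ∈ A ∧ y ∈ A
  arc_le _ _ h := h.1
  left_mem _ _ h := h.2.1
  right_mem _ _ h := h.2.2

variable {D}

namespace Sub

/-- The underlying graph of a subgraph, as a graph on `V` (the vertices of `V` outside the
subgraph are isolated in it). -/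
def under (H : D.Sub) : SimpleGraph V where
  Adj x y := H.arc x y ∨ H.arc y x
  symm := ⟨fun _ _ h => h.symm⟩
  loopless := ⟨fun x h =>
    have h' : H.arc x x := h.elim id id
    D.asymm x x (H.arc_le x x h') (H.arc_le x x h')⟩

/-- The degree of a vertex in a subgraph (the vertex set is finite in all uses). -/
noncomputable def deg (H : D.Sub) (x : V) : ℕ := (H.under.neighborSet x).ncard

/-- A walk in the underlying graph that follows the directions of the edges. -/
def IsOriented (H : D.Sub) {x y : V} (p : H.under.Walk x y) : Prop :=
  ∀ d ∈ p.darts, H.arc d.fst d.snd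

/-- There is an oriented path from `x` to `y` in `H`. -/
def HasOrientedPath (H : D.Sub) (x y : V) : Prop :=
  ∃ p : H.under.Walk x y, p.IsPath ∧ H.IsOriented p

/-- Unicycle oriented graphs: there is exactly one cycle `C`, it is an oriented cycle, every other
vertex is reached from `C` by an oriented path, and vertices of weight one have degree one.
Cycles are compared by their edge sets, since one cycle is traversed by several closed walks. -/
def IsUnicycle (B : D.Sub) : Prop :=
  (∃ (u : V) (C : B.under.Walk u u), C.IsCycle ∧
    (∀ (u' : V) (C' : B.under.Walk u' u'), C'.IsCycle → ∀ e, e ∈ C'.edges ↔ e ∈ C.edges) ∧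
    B.IsOriented C ∧
    ∀ y ∈ B.verts, y ∉ C.support → ∃ x ∈ C.support, B.HasOrientedPath x y) ∧
  ∀ x ∈ B.verts, D.weight x = 1 → B.deg x = 1

/-- Root oriented trees `T` with parent `v`. -/
def IsROT (T : D.Sub) (v : V) : Prop :=
  v ∈ T.verts ∧ T.under.IsAcyclic ∧
  (∀ x ∈ T.verts, x ≠ v → T.HasOrientedPath v x) ∧
  ∀ x ∈ T.verts, D.weight x = 1 → (T.deg x = 1 ∧ x ≠ v) ∨ (T.verts = {v} ∧ x = v)

/-- ⋆-semi-forests of `D`. -/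
def IsStarSemiForest (H : D.Sub) : Prop :=
  ∃ (r s : ℕ) (T : Fin r → D.Sub) (v : Fin r → V) (B : Fin s → D.Sub),
    (∀ i, (T i).IsROT (v i)) ∧ (∀ j, (B j).IsUnicycle) ∧
    -- `H` is the union of the `T i` and the `B j`
    H.verts = (⋃ i, (T i).verts) ∪ (⋃ j, (B j).verts) ∧
    (∀ x y, H.arc x y ↔ (∃ i, (T i).arc x y) ∨ (∃ j, (B j).arc x y)) ∧
    -- (i) their vertex sets are pairwise disjoint
    (∀ i i', i ≠ i' → Disjoint (T i).verts (T i').verts) ∧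
    (∀ j j', j ≠ j' → Disjoint (B j).verts (B j').verts) ∧
    (∀ i j, Disjoint (T i).verts (B j).verts) ∧
    -- (ii) the vertices `w i`, not necessarily distinct
    ∃ w : Fin r → V, (∀ i, w i ∉ H.verts ∧ w i ∈ D.nbr (v i)) ∧
      -- (iii) a partition of `W = {w i}` into two sets, possibly empty
      ∃ W₁ W₂ : Set V, W₁ ∪ W₂ = Set.range w ∧ Disjoint W₁ W₂ ∧
        D.graph.IsIndepSet W₁ ∧ W₂ ⊆ D.plus ∧ (∀ i, w i ∈ W₂ → D.arc (w i) (v i)) ∧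
        ∀ x ∈ W₂ ∪ ({x | x ∈ H.verts ∧ 2 ≤ H.deg x} ∪ {x | ∃ i, x = v i ∧ H.deg (v i) = 1}),
          Disjoint (D.outNbr x) W₁

/-- `K` has a generating ⋆-semi-forest. -/
def HasGeneratingStarSemiForest (K : D.Sub) : Prop :=
  ∃ H : D.Sub, H.IsStarSemiForest ∧ K.verts = H.verts

end Sub

end WOGraph

/-! Unmixedness is a statement about strong vertex covers. The associated primes of `I(D)` are the
ideals generated by the strong vertex covers (`mem_associatedPrimes_edgeIdeal`), and the height of
such a prime is the size of the cover. So `I(D)` is unmixed exactly when all strong covers have the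
same size.

The SCQ partition makes this a local question. A vertex cover misses at most one vertex of a simplex
or of an edge of `Q`, and at most two vertices of a 5-cycle. A strong cover that is also a minimal
vertex cover attains these bounds on every part (`ncard_compl_inter_of_minimal`). Hence `I(D)` is
unmixed if and only if no strong cover contains a simplex, four consecutive vertices of a basic
5-cycle, or both ends of an edge of `Q` (`isUnmixed_edgeIdeal_iff_of_isSCQ`).

These three exclusions match (b), (a) and (c). Strong covers are produced by
`WOGraph.exists_isStrong`: given an independent set `S` and a set `A` of vertices of weight greater
than one with no out-neighbour in `S`, some strong cover contains all neighbours of `S` and all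
out-neighbours of `A`. A violation of (a) or (c) provides `S` and `A` forcing a forbidden block into
a strong cover; conversely (a) and (c) contradict strongness on such a block. For (b), a vertex set
lies in a strong cover exactly when it carries a ⋆-semi-forest. From a forest one takes `S = W₁` and
`A = W₂ ∪ H̃`; from a strong cover one obtains a forest by joining each vertex to the in-neighbour
that witnesses strongness. -/

/-! ### Monomial ideals: prime colon ideals, and primes generated by variables. -/

open MvPolynomial in
/-- A polynomial is the sum of its terms with exponent in `M` and of its other terms. -/
theorem MvPolynomial.exists_add_of_support {σ R : Type*} [CommSemiring R] (M : Set (σ →₀ ℕ))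
    (f : MvPolynomial σ R) :
    ∃ g h : MvPolynomial σ R, f = g + h ∧ (∀ u, u ∈ g.support ↔ u ∈ f.support ∧ u ∈ M) ∧
      (∀ u, u ∈ h.support ↔ u ∈ f.support ∧ u ∉ M) := by
  classical
  have key : ∀ (P : (σ →₀ ℕ) → Prop) [DecidablePred P] (u : σ →₀ ℕ),
      coeff u (∑ v ∈ f.support.filter P, monomial v (coeff v f)) =
        if P u then coeff u f else 0 := by
    intro P _ u
    rw [coeff_sum]
    simp only [coeff_monomial, Finset.sum_ite_eq', Finset.mem_filter, mem_support_iff]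
    by_cases h1 : P u <;> by_cases h2 : coeff u f = 0 <;> simp [h1, h2]
  refine ⟨∑ v ∈ f.support.filter (· ∈ M), monomial v (coeff v f),
    ∑ v ∈ f.support.filter (· ∉ M), monomial v (coeff v f), ?_, ?_, ?_⟩
  · ext u
    rw [coeff_add, key, key]
    by_cases h : u ∈ M <;> simp [h]
  · intro u
    rw [mem_support_iff, key, mem_support_iff]
    by_cases h : u ∈ M <;> simp [h]
  · intro u
    rw [mem_support_iff, key, mem_support_iff]
    by_cases h : u ∈ M <;> simp [h]

open MvPolynomial in
/-- A prime ideal that is a colon ideal of a monomial ideal `I` (the ideal of the polynomials all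
of whose exponents lie in `M`) is the colon ideal of `I` by a monomial. -/
theorem MvPolynomial.exists_colon_monomial {σ K : Type*} [Finite σ] [Field K]
    {I p : Ideal (MvPolynomial σ K)} {M : Set (σ →₀ ℕ)}
    (hI : ∀ f, f ∈ I ↔ ∀ u ∈ f.support, u ∈ M) (hM : ∀ u ∈ M, ∀ v, v + u ∈ M)
    (hp : p.IsPrime) {f : MvPolynomial σ K} (hf : ∀ g, g ∈ p ↔ g * f ∈ I) :
    ∃ u : σ →₀ ℕ, ∀ g, g ∈ p ↔ ∀ v ∈ g.support, v + u ∈ M := by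
  classical
  -- `N` counts the terms outside `I`; `f` is replaced by a polynomial with the same colon ideal for
  -- which this count is minimal.
  let N : MvPolynomial σ K → ℕ := fun f => (f.support.filter (· ∉ M)).card
  obtain ⟨f, hf, hmin⟩ := (measure N).wf.has_min {f | ∀ g, g ∈ p ↔ g * f ∈ I} ⟨f, hf⟩
  simp only [Set.mem_ofPred_eq] at hf hmin
  have hsupp : ∀ v u, u ∈ (monomial v (1 : K) * f).support ↔ ∃ t ∈ f.support, u = v + t := by
    intro v u
    simp only [mem_support_iff, coeff_monomial_mul', one_mul]
    constructor
    · intro h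
      by_cases hv : v ≤ u
      · exact ⟨u - v, by simpa [hv] using h, (add_tsub_cancel_of_le hv).symm⟩
      · simp [hv] at h
    · rintro ⟨t, ht, rfl⟩
      simpa using ht
  -- If a monomial lies outside `p`, multiplying `f` by it does not change the colon ideal, as `p`
  -- is prime. By minimality the product loses no term outside `I`.
  have hstay : ∀ v, monomial v (1 : K) ∉ p → ∀ u ∈ f.support, u ∉ M → v + u ∉ M := by
    intro v hv
    have h1 : ∀ g, g ∈ p ↔ g * (monomial v (1 : K) * f) ∈ I := by
      intro g
      rw [← mul_assoc, ← hf]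
      exact ⟨fun h => p.mul_mem_right _ h, fun h => (hp.mem_or_mem h).resolve_right hv⟩
    have h2 := hmin _ h1
    have h3 : ((monomial v (1 : K) * f).support.filter (· ∉ M)) ⊆
        ((f.support.filter (fun u => v + u ∉ M)).image (v + ·)) := by
      intro u hu
      rw [Finset.mem_filter, hsupp] at hu
      obtain ⟨⟨t, ht, rfl⟩, hu⟩ := hu
      exact Finset.mem_image_of_mem _ (Finset.mem_filter.2 ⟨ht, hu⟩)
    have h4 : f.support.filter (fun u => v + u ∉ M) ⊆ f.support.filter (· ∉ M) := by
      intro u hu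
      rw [Finset.mem_filter] at hu ⊢
      exact ⟨hu.1, fun h => hu.2 (hM u h v)⟩
    have h5 : f.support.filter (fun u => v + u ∉ M) = f.support.filter (· ∉ M) := by
      apply Finset.eq_of_subset_of_card_le h4
      have h6 := (Finset.card_le_card h3).trans Finset.card_image_le
      have h7 : ¬ N (monomial v (1 : K) * f) < N f := h2
      simp only [N] at h7
      omega
    intro u hu huM
    have : u ∈ f.support.filter (· ∉ M) := Finset.mem_filter.2 ⟨hu, huM⟩
    rw [← h5, Finset.mem_filter] at this
    exact this.2
  have hone : ∃ u₀ ∈ f.support, u₀ ∉ M := by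
    by_contra! h
    exact hp.ne_top ((Ideal.eq_top_iff_one _).2 ((hf 1).2 (by rwa [one_mul, hI])))
  obtain ⟨u₀, hu₀, hu₀M⟩ := hone
  have hmon : ∀ v, monomial v (1 : K) ∈ p ↔ v + u₀ ∈ M := by
    intro v
    constructor
    · intro h
      exact (hI _).1 ((hf _).1 h) _ ((hsupp v _).2 ⟨u₀, hu₀, rfl⟩)
    · intro h
      by_contra hv
      exact hstay v hv u₀ hu₀ hu₀M h
  have hback : ∀ g : MvPolynomial σ K, (∀ v ∈ g.support, monomial v (1 : K) ∈ p) → g ∈ p := by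
    intro g hg
    rw [g.as_sum]
    refine Ideal.sum_mem _ fun v hv => ?_
    have : monomial v (coeff v g) = C (coeff v g) * monomial v 1 := by
      rw [C_mul_monomial, mul_one]
    rw [this]
    exact p.mul_mem_left _ (hg v hv)
  refine ⟨u₀, fun g => ?_⟩
  simp_rw [← hmon]
  refine ⟨fun hg => ?_, hback g⟩
  by_contra! hv
  obtain ⟨v, hv, hvp⟩ := hv
  obtain ⟨g₁, g₂, rfl, hg₁, hg₂⟩ := g.exists_add_of_support {v | monomial v (1 : K) ∈ p}
  obtain ⟨f₁, f₂, hfe, hf₁, hf₂⟩ := f.exists_add_of_support M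
  have hg₂p : g₂ ∈ p := by
    have : g₁ ∈ p := hback _ fun v hv => ((hg₁ v).1 hv).2
    simpa using p.sub_mem hg this
  have hprod : g₂ * f₂ ∈ I := by
    have h1 : f₁ ∈ I := (hI _).2 fun u hu => ((hf₁ u).1 hu).2
    have h2 := (hf _).1 hg₂p
    rw [hfe, mul_add] at h2
    simpa using I.sub_mem h2 (I.mul_mem_left g₂ h1)
  have hg₂0 : g₂ ≠ 0 := by
    rintro rfl
    have := (hg₂ v).2 ⟨hv, hvp⟩
    simp at this
  have hf₂0 : f₂ ≠ 0 := by
    rintro rfl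
    have := (hf₂ u₀).2 ⟨hu₀, hu₀M⟩
    simp at this
  -- Any monomial order will do: the leading exponent of `g₂ * f₂` is the sum of two exponents which
  -- `hstay` keeps outside `M`, although `g₂ * f₂ ∈ I`.
  let : LinearOrder σ := IsWellOrder.linearOrder WellOrderingRel
  let m : MonomialOrder σ := MonomialOrder.lex
  have hdeg := m.degree_mul hg₂0 hf₂0
  have h1 := (hI _).1 hprod _ (m.degree_mem_support (mul_ne_zero hg₂0 hf₂0))
  have h2 := (hg₂ _).1 (m.degree_mem_support hg₂0)
  have h3 := (hf₂ _).1 (m.degree_mem_support hf₂0)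
  have h4 := hstay _ h2.2 _ h3.1 h3.2
  exact h4 (hdeg ▸ h1)

open MvPolynomial in
/-- An ideal generated by variables is the kernel of the substitution of `0` for them. -/
theorem MvPolynomial.isPrime_span_X_image {σ K : Type*} [Field K] (C : Set σ) :
    (Ideal.span (X '' C : Set (MvPolynomial σ K))).IsPrime := by
  classical
  let φ : MvPolynomial σ K →ₐ[K] MvPolynomial σ K := aeval fun x => if x ∈ C then 0 else X x
  have h1 : ∀ f, f - φ f ∈ Ideal.span (X '' C : Set (MvPolynomial σ K)) := by
    intro f
    induction f using MvPolynomial.induction_on with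
    | C a => simp [φ]
    | add f g hf hg =>
      have : f + g - φ (f + g) = (f - φ f) + (g - φ g) := by rw [map_add]; ring
      rw [this]
      exact Ideal.add_mem _ hf hg
    | mul_X f x hf =>
      have h2 : X x - φ (X x) ∈ Ideal.span (X '' C : Set (MvPolynomial σ K)) := by
        by_cases hx : x ∈ C
        · simpa [φ, hx] using Ideal.subset_span (Set.mem_image_of_mem X hx)
        · simp [φ, hx]
      have : f * X x - φ (f * X x) = (f - φ f) * X x + φ f * (X x - φ (X x)) := by
        rw [map_mul]; ring
      rw [this]
      exact Ideal.add_mem _ (Ideal.mul_mem_right _ _ hf) (Ideal.mul_mem_left _ _ h2)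
  have h2 : Ideal.span (X '' C : Set (MvPolynomial σ K)) = RingHom.ker φ := by
    apply le_antisymm
    · rw [Ideal.span_le]
      rintro _ ⟨x, hx, rfl⟩
      simp [φ, RingHom.mem_ker, hx]
    · intro f hf
      have := h1 f
      rwa [(RingHom.mem_ker).1 hf, sub_zero] at this
  rw [h2]
  exact RingHom.ker_isPrime _

-- Krull's height theorem bounds the height above by the number of generators; adjoining the
-- variables one at a time gives a strictly increasing chain of primes, which bounds it below.
open MvPolynomial in
theorem MvPolynomial.height_span_X_image {σ K : Type*} [Field K] [Finite σ] (C : Set σ) :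
    (Ideal.span (X '' C : Set (MvPolynomial σ K))).height = C.ncard := by
  classical
  have := isPrime_span_X_image (K := K) (σ := σ)
  apply le_antisymm
  · refine (Ideal.height_le_card_of_mem_minimalPrimes_span (Set.toFinite (X '' C))
      (by rw [Ideal.minimalPrimes_eq_subsingleton_self]; rfl)).trans ?_
    exact_mod_cast Set.ncard_image_le (Set.toFinite C)
  · induction C, Set.toFinite C using Set.Finite.induction_on with
    | empty => simp
    | @insert x C hx hC ih =>
      rw [Set.ncard_insert_of_notMem hx]
      have hlt : Ideal.span (X '' C : Set (MvPolynomial σ K)) <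
          Ideal.span (X '' (insert x C)) := by
        refine lt_of_le_of_ne (Ideal.span_mono (Set.image_mono (Set.subset_insert _ _))) ?_
        intro h
        have h1 : (X x : MvPolynomial σ K) ∈ Ideal.span (X '' C : Set (MvPolynomial σ K)) := by
          rw [h]
          exact Ideal.subset_span (Set.mem_image_of_mem _ (Set.mem_insert _ _))
        rw [mem_ideal_span_X_image] at h1
        obtain ⟨i, hi, hi'⟩ := h1 (Finsupp.single x 1) (by simp)
        have : i = x := by
          by_contra hne
          exact hi' (Finsupp.single_eq_of_ne hne)
        exact hx (this ▸ hi)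
      have h2 := Ideal.height_add_one_le_of_lt_of_isPrime hlt
      push_cast
      exact (add_le_add_left ih 1).trans h2

/-! ### Associated primes of the edge ideal and strong vertex covers. -/

namespace WOGraph

variable {V : Type*} (D : WOGraph V)

/-- Vertex covers. -/
def IsCover (C : Set V) : Prop := ∀ x y, D.arc x y → x ∈ C ∨ y ∈ C

/-- Strong vertex covers: every vertex of the cover `C` all of whose neighbours lie in `C` is the
head of an arc whose tail has weight greater than one and all its out-neighbours in `C`. -/
def IsStrong (C : Set V) : Prop :=
  D.IsCover C ∧ ∀ x ∈ C, D.nbr x ⊆ C → ∃ y ∈ D.plus, D.arc y x ∧ D.outNbr y ⊆ C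

/-- The exponents of the monomials in the edge ideal. -/
def exponents : Set (V →₀ ℕ) := {u | ∃ x y, D.arc x y ∧ 1 ≤ u x ∧ D.weight y ≤ u y}

variable {D}

theorem arc_ne {x y : V} (h : D.arc x y) : x ≠ y := by
  rintro rfl
  exact D.asymm _ _ h h

theorem add_mem_exponents {u : V →₀ ℕ} (hu : u ∈ D.exponents) (v : V →₀ ℕ) :
    v + u ∈ D.exponents := by
  obtain ⟨x, y, h, hx, hy⟩ := hu
  exact ⟨x, y, h, by simp only [Finsupp.add_apply]; omega,
    by simp only [Finsupp.add_apply]; omega⟩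

theorem mem_edgeIdeal {K : Type*} [Field K] (f : MvPolynomial V K) :
    f ∈ D.edgeIdeal K ↔ ∀ u ∈ f.support, u ∈ D.exponents := by
  classical
  have h1 : D.edgeIdeal K = Ideal.span ((fun s => MvPolynomial.monomial s (1 : K)) ''
      {u | ∃ x y, D.arc x y ∧ u = Finsupp.single x 1 + Finsupp.single y (D.weight y)}) := by
    have h2 : ∀ x y, (MvPolynomial.X x * MvPolynomial.X y ^ D.weight y : MvPolynomial V K) =
        MvPolynomial.monomial (Finsupp.single x 1 + Finsupp.single y (D.weight y)) 1 := by
      intro x y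
      rw [MvPolynomial.X_pow_eq_monomial, MvPolynomial.X, MvPolynomial.monomial_mul, one_mul]
    unfold edgeIdeal
    congr 1
    ext f
    constructor
    · rintro ⟨x, y, h, rfl⟩
      exact ⟨_, ⟨x, y, h, rfl⟩, (h2 x y).symm⟩
    · rintro ⟨_, ⟨x, y, h, rfl⟩, rfl⟩
      exact ⟨x, y, h, (h2 x y).symm⟩
  rw [h1, MvPolynomial.mem_ideal_span_monomial_image]
  refine forall₂_congr fun u _ => ?_
  constructor
  · rintro ⟨_, ⟨x, y, h, rfl⟩, hle⟩
    have hx := hle x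
    have hy := hle y
    simp only [Finsupp.add_apply, Finsupp.single_eq_same] at hx hy
    exact ⟨x, y, h, by omega, by omega⟩
  · rintro ⟨x, y, h, hx, hy⟩
    refine ⟨_, ⟨x, y, h, rfl⟩, fun z => ?_⟩
    have hne := arc_ne h
    simp only [Finsupp.add_apply, Finsupp.single_apply]
    split_ifs with h3 h4 h4
    · exact absurd (h3.trans h4.symm) hne
    · subst h3; omega
    · subst h4; omega
    · omega

/-- The set `C` of variables generating the colon ideal of `I(D)` by a monomial is a strong
vertex cover. -/
theorem isStrong_of_colon {C : Set V} {u : V →₀ ℕ}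
    (h : ∀ v : V →₀ ℕ, (∃ x ∈ C, v x ≠ 0) ↔ v + u ∈ D.exponents) : D.IsStrong C := by
  classical
  have hu : u ∉ D.exponents := by
    intro hu
    obtain ⟨x, _, hx⟩ := (h 0).2 (by rwa [zero_add])
    exact hx rfl
  -- Raising the exponent of `x` by one creates a multiple of a generator where there was none, so
  -- `x` is the head of the arc, with exponent just one short, or its tail, with exponent zero.
  have hstep : ∀ x ∈ C, (D.weight x = u x + 1 ∧ ∃ s, D.arc s x ∧ 1 ≤ u s) ∨
      (u x = 0 ∧ ∃ t, D.arc x t ∧ D.weight t ≤ u t) := by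
    intro x hx
    obtain ⟨s, t, hst, hs, ht⟩ := (h (Finsupp.single x 1)).1 ⟨x, hx, by simp⟩
    have hne := arc_ne hst
    simp only [Finsupp.add_apply, Finsupp.single_apply] at hs ht
    have hno : ¬ (1 ≤ u s ∧ D.weight t ≤ u t) := fun h' => hu ⟨s, t, hst, h'.1, h'.2⟩
    by_cases hxs : x = s
    · subst hxs
      rw [if_neg hne] at ht
      exact Or.inr ⟨by omega, t, hst, by omega⟩
    · rw [if_neg hxs] at hs
      by_cases hxt : x = t
      · subst hxt
        rw [if_pos rfl] at ht
        exact Or.inl ⟨by omega, s, hst, by omega⟩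
      · rw [if_neg hxt] at ht
        omega
  have hlt : ∀ x ∈ C, u x < D.weight x := by
    intro x hx
    have := D.weight_pos x
    rcases hstep x hx with ⟨h1, _⟩ | ⟨h1, _⟩ <;> omega
  refine ⟨fun x y hxy => ?_, fun x hx hN => ?_⟩
  · obtain ⟨z, hz, hz'⟩ := (h (Finsupp.single x 1 + Finsupp.single y (D.weight y))).2
      ⟨x, y, hxy, by simp; omega, by simp; omega⟩
    simp only [Finsupp.add_apply, Finsupp.single_apply] at hz'
    split_ifs at hz' with h1 h2 h2
    · exact Or.inl (h1 ▸ hz)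
    · exact Or.inl (h1 ▸ hz)
    · exact Or.inr (h2 ▸ hz)
    · omega
  · rcases hstep x hx with ⟨_, s, hs, hs'⟩ | ⟨_, t, ht, ht'⟩
    · refine ⟨s, ?_, hs, fun y hy => ?_⟩
      · have := hlt s (hN (Or.inr hs))
        show 1 < D.weight s
        omega
      · obtain ⟨z, hz, hz'⟩ := (h (Finsupp.single y (D.weight y))).2
          ⟨s, y, hy, by simp only [Finsupp.add_apply]; omega, by simp⟩
        rw [Finsupp.single_apply] at hz'
        split_ifs at hz' with h1
        · exact h1 ▸ hz
        · omega
    · have := hlt t (hN (Or.inl ht))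
      omega

/-- Every strong vertex cover is the set of variables of a colon ideal of `I(D)` by a monomial. -/
theorem IsStrong.exists_colon [Finite V] {C : Set V} (hC : D.IsStrong C) :
    ∃ u : V →₀ ℕ, ∀ v : V →₀ ℕ, (∃ x ∈ C, v x ≠ 0) ↔ v + u ∈ D.exponents := by
  classical
  -- Vertices off `C` get the full weight, which serves any arc ending there. A vertex of `C` with
  -- an out-neighbour off `C` must get 0, or that arc would already give a generator. The others
  -- stay one short of their weight, so that one more factor completes a generator.
  let a : V → ℕ := fun x =>
    if x ∈ C then (if D.outNbr x ⊆ C then D.weight x - 1 else 0) else D.weight x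
  have ha1 : ∀ x ∈ C, D.outNbr x ⊆ C → a x = D.weight x - 1 := fun x h1 h2 => by simp [a, h1, h2]
  have ha2 : ∀ x ∈ C, ¬ D.outNbr x ⊆ C → a x = 0 := fun x h1 h2 => by simp [a, h1, h2]
  have ha3 : ∀ x, x ∉ C → a x = D.weight x := fun x h1 => by simp [a, h1]
  have hlt : ∀ x ∈ C, a x < D.weight x := by
    intro x hx
    have := D.weight_pos x
    by_cases h : D.outNbr x ⊆ C
    · rw [ha1 x hx h]; omega
    · rw [ha2 x hx h]; omega
  refine ⟨Finsupp.equivFunOnFinite.symm a, fun v => ⟨?_, ?_⟩⟩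
  · rintro ⟨x, hx, hv⟩
    by_cases h1 : D.outNbr x ⊆ C
    · have h2 : ∃ y, D.arc y x ∧ 1 ≤ a y := by
        by_cases h3 : D.nbr x ⊆ C
        · obtain ⟨y, hy, hyx, hyC⟩ := hC.2 x hx h3
          refine ⟨y, hyx, ?_⟩
          rw [ha1 y (h3 (Or.inr hyx)) hyC]
          have : 1 < D.weight y := hy
          omega
        · obtain ⟨y, hy, hyC⟩ := Set.not_subset.1 h3
          have hyx : D.arc y x := hy.resolve_left fun h => hyC (h1 h)
          exact ⟨y, hyx, by rw [ha3 y hyC]; exact D.weight_pos y⟩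
      obtain ⟨y, hyx, hy⟩ := h2
      refine ⟨y, x, hyx, ?_, ?_⟩
      · simp only [Finsupp.add_apply, Finsupp.equivFunOnFinite_symm_apply_apply]
        omega
      · simp only [Finsupp.add_apply, Finsupp.equivFunOnFinite_symm_apply_apply, ha1 x hx h1]
        omega
    · obtain ⟨y, hy, hyC⟩ := Set.not_subset.1 h1
      refine ⟨x, y, hy, ?_, ?_⟩
      · simp only [Finsupp.add_apply]
        omega
      · simp only [Finsupp.add_apply, Finsupp.equivFunOnFinite_symm_apply_apply, ha3 y hyC]
        omega
  · rintro ⟨x, y, hxy, hx, hy⟩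
    simp only [Finsupp.add_apply, Finsupp.equivFunOnFinite_symm_apply_apply] at hx hy
    by_contra! hv
    by_cases hyC : y ∈ C
    · have := hlt y hyC
      rw [hv y hyC] at hy
      omega
    · have hxC := (hC.1 x y hxy).resolve_right hyC
      rw [hv x hxC, ha2 x hxC fun h => hyC (h hxy)] at hx
      omega

/-- The associated primes of `I(D)` are the ideals generated by strong vertex covers. -/
theorem mem_associatedPrimes_edgeIdeal [Finite V] {K : Type*} [Field K]
    (p : Ideal (MvPolynomial V K)) :
    p ∈ associatedPrimes (MvPolynomial V K) (MvPolynomial V K ⧸ D.edgeIdeal K) ↔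
      ∃ C, D.IsStrong C ∧ p = Ideal.span (MvPolynomial.X '' C) := by
  classical
  have hcolon : ∀ f g : MvPolynomial V K,
      g ∈ (⊥ : Submodule (MvPolynomial V K) (MvPolynomial V K ⧸ D.edgeIdeal K)).colon
        {Ideal.Quotient.mk (D.edgeIdeal K) f} ↔ g * f ∈ D.edgeIdeal K := by
    intro f g
    rw [Submodule.mem_colon_singleton, Submodule.mem_bot, ← Ideal.Quotient.eq_zero_iff_mem]
    rfl
  have hmul : ∀ (g : MvPolynomial V K) (u : V →₀ ℕ),
      g * MvPolynomial.monomial u 1 ∈ D.edgeIdeal K ↔ ∀ v ∈ g.support, v + u ∈ D.exponents := by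
    intro g u
    rw [mem_edgeIdeal]
    constructor
    · intro h v hv
      refine h _ ?_
      simpa using hv
    · intro h w hw
      rw [MvPolynomial.mem_support_iff, MvPolynomial.coeff_mul_monomial'] at hw
      split_ifs at hw with hle
      · have := h (w - u) (by simpa using hw)
        rwa [tsub_add_cancel_of_le hle] at this
      · exact absurd rfl hw
  rw [AssociatedPrimes.mem_iff, isAssociatedPrime_iff]
  constructor
  · rintro ⟨hp, x, hx⟩
    obtain ⟨f, rfl⟩ := Ideal.Quotient.mk_surjective x
    obtain ⟨u, hu⟩ := MvPolynomial.exists_colon_monomial (mem_edgeIdeal (D := D))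
      (fun u hu v => add_mem_exponents hu v) hp (f := f) (fun g => by rw [hx, hcolon])
    have hmon : ∀ v, MvPolynomial.monomial v (1 : K) ∈ p ↔ v + u ∈ D.exponents := by
      intro v
      rw [hu]
      simp [MvPolynomial.support_monomial]
    have hvar : ∀ v : V →₀ ℕ, (∃ x ∈ {x | MvPolynomial.X x ∈ p}, v x ≠ 0) ↔
        v + u ∈ D.exponents := by
      intro v
      rw [← hmon]
      constructor
      · rintro ⟨x, hx, hv⟩
        have : v = (v - Finsupp.single x 1) + Finsupp.single x 1 :=
          (tsub_add_cancel_of_le (by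
            intro z
            rw [Finsupp.single_apply]
            split_ifs with h
            · subst h; omega
            · omega)).symm
        rw [this, ← one_mul (1 : K), ← MvPolynomial.monomial_mul]
        exact p.mul_mem_left _ hx
      · intro h
        rw [MvPolynomial.monomial_eq, MvPolynomial.C_1, one_mul, Finsupp.prod,
          hp.prod_mem_iff] at h
        obtain ⟨x, hx, hx'⟩ := h
        exact ⟨x, hp.mem_of_pow_mem _ hx', Finsupp.mem_support_iff.1 hx⟩
    refine ⟨_, isStrong_of_colon hvar, ?_⟩
    ext g
    rw [hu, MvPolynomial.mem_ideal_span_X_image]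
    exact forall₂_congr fun v _ => (hvar v).symm
  · rintro ⟨C, hC, rfl⟩
    obtain ⟨u, hu⟩ := hC.exists_colon
    refine ⟨MvPolynomial.isPrime_span_X_image C,
      Ideal.Quotient.mk _ (MvPolynomial.monomial u 1), ?_⟩
    ext g
    rw [hcolon, hmul, MvPolynomial.mem_ideal_span_X_image]
    exact forall₂_congr fun v _ => hu v

theorem isUnmixed_edgeIdeal_iff [Finite V] (K : Type*) [Field K] :
    IdealIsUnmixed (D.edgeIdeal K) ↔
      ∀ C C' : Set V, D.IsStrong C → D.IsStrong C' → C.ncard = C'.ncard := by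
  constructor
  · intro h C C' hC hC'
    have := h _ ((mem_associatedPrimes_edgeIdeal _).2 ⟨C, hC, rfl⟩) _
      ((mem_associatedPrimes_edgeIdeal _).2 ⟨C', hC', rfl⟩)
    rw [MvPolynomial.height_span_X_image, MvPolynomial.height_span_X_image] at this
    exact_mod_cast this
  · intro h p hp q hq
    obtain ⟨C, hC, rfl⟩ := (mem_associatedPrimes_edgeIdeal _).1 hp
    obtain ⟨C', hC', rfl⟩ := (mem_associatedPrimes_edgeIdeal _).1 hq
    rw [MvPolynomial.height_span_X_image, MvPolynomial.height_span_X_image, h C C' hC hC']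

end WOGraph

/-! ### Construction of strong covers, and the local conditions on edges and 5-cycles. -/

namespace WOGraph

variable {V : Type*} {D : WOGraph V}

theorem mem_nbr {x y : V} : y ∈ D.nbr x ↔ D.graph.Adj x y := (D.adj_iff x y).symm

theorem mem_nbr_comm {x y : V} : y ∈ D.nbr x ↔ x ∈ D.nbr y := by
  rw [mem_nbr, mem_nbr, SimpleGraph.adj_comm]

theorem IsCover.nbr_subset {C : Set V} (hC : D.IsCover C) {x : V} (hx : x ∉ C) :
    D.nbr x ⊆ C := by
  rintro y (hy | hy)
  · exact (hC _ _ hy).resolve_left hx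
  · exact (hC _ _ hy).resolve_right hx

/-- A vertex cover that is minimal among those that avoid `S` and contain all out-neighbours of
`A` is strong. -/
theorem exists_isStrong [Finite V] (S A : Set V) (hS : D.graph.IsIndepSet S) (hA : A ⊆ D.plus)
    (hAS : ∀ a ∈ A, Disjoint (D.outNbr a) S) :
    ∃ C, D.IsStrong C ∧ (∀ a ∈ A, D.outNbr a ⊆ C) ∧ (∀ s ∈ S, D.nbr s ⊆ C) ∧
      ∀ x ∈ C, D.nbr x ⊆ C → ∃ a ∈ A, D.arc a x := by
  let F : Set (Set V) := {C | D.IsCover C ∧ (∀ a ∈ A, D.outNbr a ⊆ C) ∧ ∀ s ∈ S, s ∉ C}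
  have hF : Sᶜ ∈ F := by
    refine ⟨fun x y hxy => ?_, fun a ha y hy hyS => (hAS a ha).le_bot ⟨hy, hyS⟩,
      fun s hs h => h hs⟩
    by_contra! h
    simp only [Set.mem_compl_iff, not_not] at h
    exact hS h.1 h.2 (arc_ne hxy) ((D.adj_iff x y).2 (Or.inl hxy))
  obtain ⟨C, hC⟩ := (Set.toFinite F).exists_minimal ⟨_, hF⟩
  have hL3 : ∀ x ∈ C, D.nbr x ⊆ C → ∃ a ∈ A, D.arc a x := by
    intro x hx hN
    by_contra! h
    -- All neighbours of `x` are in `C` and no vertex of `A` requires `x`, so dropping `x` would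
    -- contradict minimality.
    have h1 : C \ {x} ∈ F := by
      refine ⟨fun y z hyz => ?_, fun a ha y hy => ⟨hC.prop.2.1 a ha hy, ?_⟩,
        fun s hs hsC => hC.prop.2.2 s hs hsC.1⟩
      · by_cases hy : y = x
        · subst hy
          exact Or.inr ⟨hN (Or.inl hyz), (arc_ne hyz).symm⟩
        · by_cases hz : z = x
          · subst hz
            exact Or.inl ⟨hN (Or.inr hyz), arc_ne hyz⟩
          · exact (hC.prop.1 y z hyz).imp (fun h => ⟨h, hy⟩) (fun h => ⟨h, hz⟩)
      · rintro rfl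
        exact h a ha hy
    exact (hC.le_of_le h1 Set.sdiff_subset hx).2 rfl
  refine ⟨C, ⟨hC.prop.1, fun x hx hN => ?_⟩, hC.prop.2.1,
    fun s hs => hC.prop.1.nbr_subset (hC.prop.2.2 s hs), hL3⟩
  obtain ⟨a, ha, hax⟩ := hL3 x hx hN
  exact ⟨a, hA ha, hax, hC.prop.2.1 a ha⟩

/-! ### Edges with property (P) -/

/-- Neighbours of `b` and of `b'` outside `C` would be adjacent by (P), giving an uncovered edge. -/
theorem nbr_subset_of_propertyP {b b' : V} {C : Set V} (hP : SCQ.PropertyP D.graph s(b, b'))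
    (hC : D.IsCover C) : D.nbr b ⊆ C ∨ D.nbr b' ⊆ C := by
  by_contra! h
  obtain ⟨⟨a, ha, haC⟩, ⟨a', ha', haC'⟩⟩ := h.imp Set.not_subset.1 Set.not_subset.1
  have := hP a b a' b' rfl (mem_nbr.1 ha).symm (mem_nbr.1 ha').symm
  exact haC' (hC.nbr_subset haC (mem_nbr.2 this))

/-- By (P) one end has all its neighbours in `C`. A witness `y` of strongness there forces the same
for the other end, which then has a witness `y'`. The two hypotheses yield both arcs between `y` and
`y'`, which is impossible. -/
theorem IsStrong.not_both_mem_of_edge {b b' : V} {C : Set V}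
    (hP : SCQ.PropertyP D.graph s(b, b')) (hC : D.IsStrong C)
    (h1 : ∀ a ∈ D.plus, D.arc a b' → D.nbr b ⊆ D.outNbr a)
    (h2 : ∀ a ∈ D.plus, D.arc a b → D.nbr b' ⊆ D.outNbr a) : ¬ (b ∈ C ∧ b' ∈ C) := by
  have key : ∀ b b', (∀ a ∈ D.plus, D.arc a b' → D.nbr b ⊆ D.outNbr a) →
      (∀ a ∈ D.plus, D.arc a b → D.nbr b' ⊆ D.outNbr a) → b ∈ C → b' ∈ C → ¬ D.nbr b ⊆ C := by
    intro b b' h1 h2 hb hb' hN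
    obtain ⟨y, hy, hyb, hyC⟩ := hC.2 b hb hN
    obtain ⟨y', hy', hyb', -⟩ := hC.2 b' hb' ((h2 y hy hyb).trans hyC)
    exact D.asymm _ _ (h1 y' hy' hyb' (Or.inr hyb)) (h2 y hy hyb (Or.inr hyb'))
  rintro ⟨hb, hb'⟩
  rcases nbr_subset_of_propertyP hP hC.1 with h | h
  · exact key b b' h1 h2 hb hb' h
  · exact key b' b h2 h1 hb' hb h

/-- A neighbour `c` of `b` outside `N⁺(a)` would allow a strong cover with `S = {c}` and `A = {a}`;
it contains `b` because of `c` and `b'` because of `a`. -/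
theorem outNbr_of_edge [Finite V] {a b b' : V}
    (h : ∀ C, D.IsStrong C → ¬ (b ∈ C ∧ b' ∈ C)) (ha : a ∈ D.plus) (hab : D.arc a b') :
    D.nbr b ⊆ D.outNbr a := by
  intro c hc
  by_contra hca
  obtain ⟨C, hC, hA, hS, -⟩ := exists_isStrong (D := D) {c} {a} (by simp)
    (by simpa using ha) (by simpa using hca)
  exact h C hC ⟨hS c rfl (mem_nbr_comm.1 hc), hA a rfl hab⟩

/-! ### Five-cycles -/

variable (D) in
/-- The vertices `p`, `q`, `r`, `s`, `t` form, in this order, an induced 5-cycle with vertex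
set `A`. -/
structure IsFiveCycle (A : Set V) (p q r s t : V) : Prop where
  eq : A = {p, q, r, s, t}
  adj : D.graph.Adj p q ∧ D.graph.Adj q r ∧ D.graph.Adj r s ∧ D.graph.Adj s t ∧ D.graph.Adj t p
  not_adj : ¬ D.graph.Adj p r ∧ ¬ D.graph.Adj q s ∧ ¬ D.graph.Adj r t ∧ ¬ D.graph.Adj s p ∧
    ¬ D.graph.Adj t q

namespace IsFiveCycle

variable {A : Set V} {p q r s t : V}

theorem rotate (h : D.IsFiveCycle A p q r s t) : D.IsFiveCycle A q r s t p := by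
  obtain ⟨he, ⟨h1, h2, h3, h4, h5⟩, h6, h7, h8, h9, h10⟩ := h
  refine ⟨?_, ⟨h2, h3, h4, h5, h1⟩, h7, h8, h9, h10, h6⟩
  rw [he]; ext x; simp only [Set.mem_insert_iff, Set.mem_singleton_iff]; tauto

theorem reflect (h : D.IsFiveCycle A p q r s t) : D.IsFiveCycle A t s r q p := by
  obtain ⟨he, ⟨h1, h2, h3, h4, h5⟩, h6, h7, h8, h9, h10⟩ := h
  refine ⟨?_, ⟨h4.symm, h3.symm, h2.symm, h1.symm, h5.symm⟩, fun h => h8 h.symm,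
    fun h => h7 h.symm, fun h => h6 h.symm, fun h => h10 h.symm, fun h => h9 h.symm⟩
  rw [he]; ext x; simp only [Set.mem_insert_iff, Set.mem_singleton_iff]; tauto

theorem nbr_inter (h : D.IsFiveCycle A p q r s t) {x : V} (hx : x ∈ D.nbr q) (hxA : x ∈ A) :
    x = p ∨ x = r := by
  obtain ⟨he, -, h6, h7, h8, h9, h10⟩ := h
  rw [mem_nbr] at hx
  rw [he] at hxA
  rcases hxA with rfl | rfl | rfl | rfl | rfl
  · exact Or.inl rfl
  · exact absurd hx (SimpleGraph.irrefl _)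
  · exact Or.inr rfl
  · exact absurd hx h7
  · exact absurd hx.symm h10

theorem ne (h : D.IsFiveCycle A p q r s t) : p ≠ q ∧ p ≠ r ∧ p ≠ s ∧ p ≠ t := by
  obtain ⟨he, ⟨h1, h2, h3, h4, h5⟩, h6, h7, h8, h9, h10⟩ := h
  exact ⟨h1.ne, fun e => h9 (e ▸ h3.symm), fun e => h6 (e ▸ h3.symm), h5.ne'⟩

end IsFiveCycle

theorem isFiveCycle_of_embedding (z : SimpleGraph.cycleGraph 5 ↪g D.graph) :
    D.IsFiveCycle (Set.range z) (z 0) (z 1) (z 2) (z 3) (z 4) := by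
  refine ⟨?_, ?_, ?_⟩
  · ext x
    constructor
    · rintro ⟨i, rfl⟩
      fin_cases i <;> simp
    · rintro (rfl | rfl | rfl | rfl | rfl) <;> exact ⟨_, rfl⟩
  · simp only [z.map_adj_iff]
    decide
  · simp only [z.map_adj_iff]
    decide

theorem IsFiveCycle.exists_embedding {A : Set V} {p q r s t : V}
    (h : D.IsFiveCycle A p q r s t) : ∃ z : SimpleGraph.cycleGraph 5 ↪g D.graph,
      Set.range z = A ∧ z 0 = p ∧ z 1 = q ∧ z 2 = r ∧ z 3 = s ∧ z 4 = t := by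
  obtain ⟨a1, a2, a3, a4⟩ := h.ne
  obtain ⟨b1, b2, b3, -⟩ := h.rotate.ne
  obtain ⟨c1, c2, -⟩ := h.rotate.rotate.ne
  obtain ⟨d1, -⟩ := h.rotate.rotate.rotate.ne
  obtain ⟨he, ⟨h1, h2, h3, h4, h5⟩, h6, h7, h8, h9, h10⟩ := h
  have hinj : Function.Injective ![p, q, r, s, t] := by
    intro i j hij
    fin_cases i <;> fin_cases j <;> simp_all
  have hadj : ∀ i j, D.graph.Adj (![p, q, r, s, t] i) (![p, q, r, s, t] j) ↔
      (SimpleGraph.cycleGraph 5).Adj i j := by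
    have hlt : ∀ i j, i < j → (D.graph.Adj (![p, q, r, s, t] i) (![p, q, r, s, t] j) ↔
        (SimpleGraph.cycleGraph 5).Adj i j) := by
      intro i j hij
      fin_cases i <;> fin_cases j <;> first
        | exact absurd hij (by decide)
        | exact iff_of_true (by assumption) (by decide)
        | exact iff_of_true (SimpleGraph.Adj.symm (by assumption)) (by decide)
        | exact iff_of_false (by assumption) (by decide)
        | exact iff_of_false (fun h => (by assumption : ¬ D.graph.Adj _ _) h.symm) (by decide)
    intro i j
    rcases lt_trichotomy i j with h | rfl | h
    · exact hlt i j h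
    · simp
    · rw [SimpleGraph.adj_comm, hlt j i h, SimpleGraph.adj_comm]
  have hrange : Set.range ![p, q, r, s, t] = A := by
    rw [he]
    ext x
    simp [eq_comm]
    tauto
  exact ⟨⟨⟨_, hinj⟩, hadj _ _⟩, hrange, rfl, rfl, rfl, rfl, rfl⟩

variable (D) in
/-- The condition that the ⋆-property of a 5-cycle `(a', a, b, b', c)` puts on the arc `(a, b)`. -/
def StarCondition (a' a b' c : V) : Prop :=
  (D.arc a' a ∧ D.weight a' = 1) ∧
    (D.inNbr a ⊆ D.nbr c ∧ D.inNbr a ∩ D.plus ⊆ D.inNbr c) ∧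
    (D.nbr b' ⊆ D.nbr a' ∪ D.outNbr a ∧ D.inNbr b' ∩ D.plus ⊆ D.inNbr a')

theorem hasStarProperty_iff {A : Set V} : D.HasStarProperty A ↔
    ∀ p q r s t, D.IsFiveCycle A p q r s t → D.arc q r → q ∈ D.plus →
      D.StarCondition p q s t := by
  constructor
  · intro h p q r s t hc h1 h2
    obtain ⟨z, hz, rfl, rfl, rfl, rfl, rfl⟩ := hc.exists_embedding
    exact h z hz h1 h2
  · intro h z hz h1 h2
    exact h _ _ _ _ _ (hz ▸ isFiveCycle_of_embedding z) h1 h2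

/-- On a basic 5-cycle, one of any two adjacent vertices has no neighbours outside the cycle. -/
theorem exists_isFiveCycle_of_mem_basicFiveCycles [Finite V] {A : Set V}
    (hA : A ∈ SCQ.basicFiveCycles D.graph) :
    (∃ p q r s t, D.IsFiveCycle A p q r s t) ∧
      ∀ p q r s t, D.IsFiveCycle A p q r s t → D.nbr p ⊆ A ∨ D.nbr q ⊆ A := by
  classical
  obtain ⟨z, hz, rfl⟩ := hA
  refine ⟨⟨_, _, _, _, _, isFiveCycle_of_embedding z⟩, fun p q r s t h => ?_⟩
  have key : ∀ p q r s t, D.IsFiveCycle (Set.range z) p q r s t → ¬ D.nbr q ⊆ Set.range z →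
      3 ≤ SCQ.deg D.graph q := by
    intro p q r s t h hq
    obtain ⟨d, hd, hdA⟩ := Set.not_subset.1 hq
    have hdp : d ≠ p := fun e => hdA (by rw [h.eq, e]; simp)
    have hdr : d ≠ r := fun e => hdA (by rw [h.eq, e]; simp)
    have h1 : (({d, p, r} : Finset V) : Set V).ncard = 3 := by
      rw [Set.ncard_coe_finset]
      simp [hdp, hdr, h.ne.2.1]
    rw [← h1]
    apply Set.ncard_le_ncard _ (Set.toFinite _)
    intro x hx
    simp only [Finset.coe_insert, Finset.coe_singleton, Set.mem_insert_iff,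
      Set.mem_singleton_iff] at hx
    rcases hx with rfl | rfl | rfl
    · exact mem_nbr.1 hd
    · exact h.adj.1.symm
    · exact h.adj.2.1
  by_contra! hpq
  have hp := key _ _ _ _ _ h.rotate.rotate.rotate.rotate hpq.1
  have hq := key _ _ _ _ _ h hpq.2
  obtain ⟨i, hi⟩ : p ∈ Set.range z := by rw [h.eq]; simp
  obtain ⟨j, hj⟩ : q ∈ Set.range z := by rw [h.eq]; simp
  exact hz i j (by rw [hi, hj]; exact h.adj.1) (by rw [hi, hj]; exact ⟨hp, hq⟩)

/-- On a basic 5-cycle with the ⋆-property, an arc `(a, b)` cannot witness that a vertex cover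
containing four of the five vertices is strong at `b`. -/
theorem IsStrong.false_of_arc {A C : Set V} {a' a b b' c : V}
    (h : D.IsFiveCycle A a' a b b' c)
    (hbasic : ∀ p q r s t, D.IsFiveCycle A p q r s t → D.nbr p ⊆ A ∨ D.nbr q ⊆ A)
    (hstar : ∀ p q r s t, D.IsFiveCycle A p q r s t → D.arc q r → q ∈ D.plus →
      D.StarCondition p q s t)
    (hC : D.IsStrong C) (ha : a ∈ C) (hb : b ∈ C) (hb' : b' ∈ C) (hac : a' ∈ C ∨ c ∈ C)
    (hab : D.arc a b) (hplus : a ∈ D.plus) (hout : D.outNbr a ⊆ C) : False := by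
  obtain ⟨⟨-, hw⟩, ⟨h2, h2'⟩, h3, h3'⟩ := hstar _ _ _ _ _ h hab hplus
  -- If `a' ∉ C`, then (⋆.3) puts all neighbours of `b'` in `C`, and the witness at `b'` also points
  -- to `a'`, forcing `a' ∈ C`.
  by_cases ha' : a' ∈ C
  swap
  · obtain ⟨y, hy, hyb, hyC⟩ := hC.2 b' hb' (h3.trans
      (Set.union_subset (hC.1.nbr_subset ha') hout))
    exact ha' (hyC (h3' ⟨hyb, hy⟩))
  -- By (⋆.2), either the witness at `a` also points to `c`, or an in-neighbour of `a` outside `C`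
  -- is adjacent to `c`.
  have hc : c ∈ C := by
    by_cases hN : D.nbr a ⊆ C
    · obtain ⟨d, hd, hda, hdC⟩ := hC.2 a ha hN
      exact hdC (h2' ⟨hda, hd⟩)
    · obtain ⟨d, hd, hdC⟩ := Set.not_subset.1 hN
      have hda : D.arc d a := hd.resolve_left fun h => hdC (hout h)
      exact hC.1.nbr_subset hdC (mem_nbr_comm.1 (h2 hda))
  have hAC : A ⊆ C := by
    rw [h.eq]
    rintro x (rfl | rfl | rfl | rfl | rfl) <;> assumption
  -- Now the whole cycle lies in `C`. Strongness at `b'`, or else a neighbour of `b'` outside `C`,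
  -- yields a vertex off the cycle adjacent to both `b'` and `a'`. As the cycle is basic, `c` and
  -- `a` then have no neighbours outside it.
  have hd : ∃ d, d ∉ A ∧ d ∈ D.nbr b' ∧ (D.arc d b' ∨ d ∉ C) ∧ d ∈ D.nbr a' := by
    by_cases hN : D.nbr b' ⊆ C
    · obtain ⟨d, hd, hdb, hdC⟩ := hC.2 b' hb' hN
      have hda' : D.arc d a' := h3' ⟨hdb, hd⟩
      refine ⟨d, fun hdA => ?_, Or.inr hdb, Or.inl hdb, Or.inr hda'⟩
      rcases h.rotate.rotate.nbr_inter (Or.inr hdb) hdA with rfl | rfl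
      · exact h.not_adj.1 ((D.adj_iff _ _).2 (Or.inr hda'))
      · have := hstar _ _ _ _ _ h.reflect.rotate.rotate.rotate.rotate hdb hd
        exact D.asymm _ _ this.1.1 hda'
    · obtain ⟨d, hd, hdC⟩ := Set.not_subset.1 hN
      exact ⟨d, fun h => hdC (hAC h), hd, Or.inr hdC, (h3 hd).resolve_right fun h => hdC (hout h)⟩
  obtain ⟨d, hdA, hdb, hdb', hda⟩ := hd
  have hcA : D.nbr c ⊆ A :=
    (hbasic _ _ _ _ _ h.rotate.rotate.rotate).resolve_left fun h => hdA (h hdb)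
  have haA : D.nbr a ⊆ A := (hbasic _ _ _ _ _ h).resolve_left fun h => hdA (h hda)
  obtain ⟨y, hy, hyc, hyC⟩ := hC.2 c hc (hcA.trans hAC)
  -- The witness at `c` is `b'`, since `a'` has weight one. Applying (⋆.2) to the arc `(b', c)`
  -- makes `d` adjacent to `a`, a contradiction.
  have hyb : y = b' := by
    refine (h.rotate.rotate.rotate.nbr_inter (Or.inr hyc) (hcA (Or.inr hyc))).resolve_right ?_
    rintro rfl
    have : 1 < D.weight y := hy
    omega
  subst hyb
  obtain ⟨-, ⟨h2, -⟩, -⟩ := hstar _ _ _ _ _ h.rotate.rotate hyc hy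
  have hdy : D.arc d y := by
    rcases hdb' with h | h
    · exact h
    · exact hdb.resolve_left fun h' => h (hyC h')
  exact hdA (haA (h2 hdy))

/-- As the cycle is basic, `q` or `r` has all its neighbours on the cycle, hence in `C`. Its witness
is then the tail of an arc of the cycle, which `IsStrong.false_of_arc` excludes. -/
theorem IsStrong.not_four_mem {A C : Set V} {p q r s t : V}
    (h : D.IsFiveCycle A p q r s t)
    (hbasic : ∀ p q r s t, D.IsFiveCycle A p q r s t → D.nbr p ⊆ A ∨ D.nbr q ⊆ A)
    (hstar : D.HasStarProperty A) (hC : D.IsStrong C)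
    (hp : p ∈ C) (hq : q ∈ C) (hr : r ∈ C) (hs : s ∈ C) : False := by
  rw [hasStarProperty_iff] at hstar
  have key : ∀ p q r s t, D.IsFiveCycle A p q r s t → p ∈ C → q ∈ C → r ∈ C → s ∈ C →
      ¬ D.nbr q ⊆ A := by
    intro p q r s t h hp hq hr hs hN
    obtain ⟨y, hy, hyq, hyC⟩ := hC.2 q hq fun x hx => by
      rcases h.nbr_inter hx (hN hx) with rfl | rfl <;> assumption
    rcases h.nbr_inter (Or.inr hyq) (hN (Or.inr hyq)) with rfl | rfl
    · exact hC.false_of_arc h.rotate.rotate.rotate.rotate hbasic hstar hp hq hr (Or.inr hs)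
        hyq hy hyC
    · exact hC.false_of_arc h.reflect.rotate hbasic hstar hr hq hp (Or.inl hs) hyq hy hyC
  rcases hbasic _ _ _ _ _ h.rotate with h1 | h1
  · exact key _ _ _ _ _ h hp hq hr hs h1
  · exact key _ _ _ _ _ h.reflect.rotate hs hr hq hp h1

/-- Each failing clause supplies the data of `exists_isStrong`. Avoiding `c` forces `a'` and `b'`
into the cover, avoiding `a'` forces `a` and `c`, and `a ∈ A` forces `b`; the offending vertex
forces the fourth one. -/
theorem hasStarProperty_of_forall_isStrong [Finite V] {A : Set V}
    (hsource : ∀ x, D.IsSource x → D.weight x = 1)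
    (h : ∀ C, D.IsStrong C → ∀ p q r s t, D.IsFiveCycle A p q r s t →
      ¬ (p ∈ C ∧ q ∈ C ∧ r ∈ C ∧ s ∈ C)) : D.HasStarProperty A := by
  rw [hasStarProperty_iff]
  -- A vertex of weight greater than one is not a source, so it has an in-neighbour `d`. If `q`
  -- pointed to both cycle neighbours, `S = {d}` and `A = {q}` would force `p`, `q`, `r`, and the
  -- edge between `s` and `t` adds a fourth vertex.
  have hprev : ∀ p q r s t, D.IsFiveCycle A p q r s t → D.arc q r → q ∈ D.plus → D.arc p q := by
    intro p q r s t hc hqr hq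
    by_contra hpq
    have hqp : D.arc q p := ((D.adj_iff _ _).1 hc.adj.1).resolve_left hpq
    have hns : ¬ D.IsSource q := fun hs => by
      have := hsource q hs
      have : 1 < D.weight q := hq
      omega
    obtain ⟨d, hd⟩ := Set.nonempty_iff_ne_empty.2 hns
    obtain ⟨C, hC, hA, hS, -⟩ := exists_isStrong (D := D) {d} {q} (by simp) (by simpa using hq)
      (by rintro x rfl; exact Set.disjoint_singleton_right.2 (D.asymm _ _ hd))
    have hpC := hA q rfl hqp
    have hrC := hA q rfl hqr
    have hqC : q ∈ C := hS d rfl (Or.inl hd)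
    by_cases hs : s ∈ C
    · exact h C hC _ _ _ _ _ hc ⟨hpC, hqC, hrC, hs⟩
    · have ht : t ∈ C := hC.1.nbr_subset hs (mem_nbr.2 hc.adj.2.2.2.1)
      exact h C hC _ _ _ _ _ hc.rotate.rotate.rotate.rotate ⟨ht, hpC, hqC, hrC⟩
  intro a' a b b' c hc hab ha
  have haa := hprev _ _ _ _ _ hc hab ha
  obtain ⟨h1, h2, h3, h4, h5⟩ := hc.adj
  obtain ⟨n1, n2, n3, n4, n5⟩ := hc.not_adj
  have hca : ¬ D.arc a c := fun h => n5 ((D.adj_iff _ _).2 (Or.inr h))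
  refine ⟨⟨haa, ?_⟩, ⟨fun d hd => ?_, fun d hd => ?_⟩, fun d hd => ?_, fun d hd => ?_⟩
  · by_contra hw
    have ha' : a' ∈ D.plus := by
      have := D.weight_pos a'
      show 1 < D.weight a'
      omega
    have hca' := hprev _ _ _ _ _ hc.rotate.rotate.rotate.rotate haa ha'
    obtain ⟨C, hC, hA, hS, -⟩ := exists_isStrong (D := D) {c} {a, a'} (by simp)
      (by rintro x (rfl | rfl) <;> assumption)
      (by
        rintro x (rfl | rfl)
        · exact Set.disjoint_singleton_right.2 hca
        · exact Set.disjoint_singleton_right.2 (D.asymm _ _ hca'))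
    exact h C hC _ _ _ _ _ hc ⟨hS c rfl (mem_nbr.2 h5), hA a' (by simp) haa,
      hA a (by simp) hab, hS c rfl (mem_nbr.2 h4.symm)⟩
  · by_contra hdc
    have hd' : D.arc d a := hd
    obtain ⟨C, hC, hA, hS, -⟩ := exists_isStrong (D := D) {c, d} {a}
      (by
        rw [mem_nbr] at hdc
        rintro x (rfl | rfl) y (rfl | rfl) hne
        · exact absurd rfl hne
        · exact hdc
        · exact fun h => hdc h.symm
        · exact absurd rfl hne)
      (by simpa using ha)
      (by
        rintro x rfl
        rw [Set.disjoint_right]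
        rintro y (rfl | rfl)
        · exact hca
        · exact D.asymm _ _ hd')
    exact h C hC _ _ _ _ _ hc ⟨hS c (by simp) (mem_nbr.2 h5), hS d (by simp) (Or.inl hd'),
      hA a rfl hab, hS c (by simp) (mem_nbr.2 h4.symm)⟩
  · by_contra hdc
    obtain ⟨C, hC, hA, hS, -⟩ := exists_isStrong (D := D) {c} {a, d} (by simp)
      (by rintro x (rfl | rfl); exacts [ha, hd.2])
      (by
        rintro x (rfl | rfl)
        · exact Set.disjoint_singleton_right.2 hca
        · exact Set.disjoint_singleton_right.2 hdc)
    exact h C hC _ _ _ _ _ hc ⟨hS c rfl (mem_nbr.2 h5), hA d (by simp) hd.1,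
      hA a (by simp) hab, hS c rfl (mem_nbr.2 h4.symm)⟩
  · by_contra hdu
    have hda : ¬ D.graph.Adj a' d := fun h => hdu (Or.inl (mem_nbr.2 h))
    obtain ⟨C, hC, hA, hS, -⟩ := exists_isStrong (D := D) {a', d} {a}
      (by
        rintro x (rfl | rfl) y (rfl | rfl) hne
        · exact absurd rfl hne
        · exact hda
        · exact fun h => hda h.symm
        · exact absurd rfl hne)
      (by simpa using ha)
      (by
        rintro x rfl
        rw [Set.disjoint_right]
        rintro y (rfl | rfl)
        · exact D.asymm _ _ haa
        · exact fun h => hdu (Or.inr h))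
    exact h C hC _ _ _ _ _ hc.rotate ⟨hS a' (by simp) (mem_nbr.2 h1), hA a rfl hab,
      hS d (by simp) (mem_nbr_comm.1 hd), hS a' (by simp) (mem_nbr.2 h5.symm)⟩
  · by_contra hda
    obtain ⟨C, hC, hA, hS, -⟩ := exists_isStrong (D := D) {a'} {a, d} (by simp)
      (by rintro x (rfl | rfl); exacts [ha, hd.2])
      (by
        rintro x (rfl | rfl)
        · exact Set.disjoint_singleton_right.2 (D.asymm _ _ haa)
        · exact Set.disjoint_singleton_right.2 hda)
    exact h C hC _ _ _ _ _ hc.rotate ⟨hS a' rfl (mem_nbr.2 h1), hA a (by simp) hab,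
      hA d (by simp) hd.1, hS a' rfl (mem_nbr.2 h5.symm)⟩

end WOGraph

/-! ### Cycles of finite relations, and ⋆-semi-forests inside strong covers. -/

open Relation

/-- In a finite type, a relation under which every element of `S` has a successor in `S` leads from
each element of `S` to a cycle. -/
theorem Relation.exists_transGen_self {α : Type*} [Finite α] {R : α → α → Prop} {S : Set α}
    (hS : ∀ x ∈ S, ∃ y ∈ S, R x y) {x : α} (hx : x ∈ S) :
    ∃ z ∈ S, ReflTransGen R x z ∧ TransGen R z z := by
  -- Among the elements of `S` reached from `x`, take `z` reaching as few elements as possible: a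
  -- successor of `z` in `S` reaches no fewer, so it reaches `z`.
  obtain ⟨z, ⟨hzS, hxz⟩, hmin⟩ :=
    (measure fun y => {z | ReflTransGen R y z}.ncard).wf.has_min
      {y | y ∈ S ∧ ReflTransGen R x y} ⟨x, hx, .refl⟩
  obtain ⟨y, hy, hzy⟩ := hS z hzS
  have hsub : {t | ReflTransGen R y t} ⊆ {t | ReflTransGen R z t} := fun t ht => .head hzy ht
  have hle : ¬ {t | ReflTransGen R y t}.ncard < {t | ReflTransGen R z t}.ncard :=
    hmin y ⟨hy, hxz.tail hzy⟩
  have heq := Set.eq_of_subset_of_ncard_le hsub (by omega) (Set.toFinite _)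
  have hyz : z ∈ {t | ReflTransGen R y t} := by
    rw [heq]
    exact ReflTransGen.refl
  exact ⟨z, hzS, hxz, TransGen.head' hzy hyz⟩

namespace WOGraph

variable {V : Type*} {D : WOGraph V}

namespace Sub

theorem two_le_deg [Finite V] {P : D.Sub} {x y z : V} (hy : P.under.Adj x y)
    (hz : P.under.Adj x z) (hne : y ≠ z) : 2 ≤ P.deg x := by
  rw [← Set.ncard_pair hne]
  apply Set.ncard_le_ncard _ (Set.toFinite _)
  rintro t (rfl | rfl) <;> assumption

theorem exists_arc_of_isPath {P : D.Sub} {u x : V} (p : P.under.Walk u x) (hp : p.IsPath)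
    (ho : P.IsOriented p) (hne : u ≠ x) :
    ∃ y, P.arc y x ∧ (y = u ∨ ∃ y', P.arc y' y ∧ y' ≠ x) := by
  induction p with
  | nil => exact absurd rfl hne
  | @cons u v x h q ih =>
    have huv : P.arc u v := ho ⟨(u, v), h⟩ (by simp)
    by_cases hvx : v = x
    · subst hvx
      exact ⟨u, huv, Or.inl rfl⟩
    · obtain ⟨y, hy, hy'⟩ := ih hp.of_cons (fun d hd => ho d (by simp [hd])) hvx
      refine ⟨y, hy, Or.inr ?_⟩
      rcases hy' with rfl | h
      · exact ⟨u, huv, hne⟩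
      · exact h

/-- The last arc of an oriented path from `u` starts at `u` or at a vertex of degree at least
two. -/
theorem HasOrientedPath.exists_arc [Finite V] {P : D.Sub} {u x : V} (h : P.HasOrientedPath u x)
    (hne : u ≠ x) : ∃ y, P.arc y x ∧ (y = u ∨ 2 ≤ P.deg y) := by
  obtain ⟨p, hp, ho⟩ := h
  obtain ⟨y, hy, hy'⟩ := exists_arc_of_isPath p hp ho hne
  refine ⟨y, hy, hy'.imp_right ?_⟩
  rintro ⟨y', h1, h2⟩
  exact two_le_deg (Or.inr h1) (Or.inl hy) h2

theorem exists_dart_snd {G : SimpleGraph V} {u : V} {c : G.Walk u u} (hc : ¬ c.Nil) {x : V}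
    (hx : x ∈ c.support) : ∃ d ∈ c.darts, d.snd = x := by
  have : x ∈ c.support.tail := by
    rcases (SimpleGraph.Walk.mem_support_iff c).1 hx with rfl | h
    · exact SimpleGraph.Walk.end_mem_tail_support hc
    · exact h
  rw [← SimpleGraph.Walk.map_snd_darts] at this
  simpa using this

theorem exists_dart_fst {G : SimpleGraph V} {u : V} {c : G.Walk u u} (hc : ¬ c.Nil) {x : V}
    (hx : x ∈ c.support) : ∃ d ∈ c.darts, d.fst = x := by
  obtain ⟨d, hd, hdx⟩ := exists_dart_snd (c := c.reverse) (by simpa using hc) (x := x)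
    (by simpa using hx)
  exact ⟨d.symm, by simpa using hd, by simpa using hdx⟩

/-- The in-arc comes from the predecessor on the oriented cycle, or from the last arc of a path
leaving the cycle. A cycle vertex has degree at least two since no edge is oriented both ways. -/
theorem IsUnicycle.exists_arc [Finite V] {B : D.Sub} (hB : B.IsUnicycle) {x : V}
    (hx : x ∈ B.verts) : ∃ y, B.arc y x ∧ 2 ≤ B.deg y := by
  obtain ⟨⟨u, c, hc, -, ho, hpath⟩, -⟩ := hB
  have hdeg : ∀ y ∈ c.support, 2 ≤ B.deg y := by
    intro y hy
    obtain ⟨d, hd, rfl⟩ := exists_dart_snd hc.not_nil hy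
    obtain ⟨d', hd', he⟩ := exists_dart_fst hc.not_nil hy
    have h1 : B.arc d.fst d.snd := ho d hd
    have h2 : B.arc d'.fst d'.snd := ho d' hd'
    rw [he] at h2
    refine two_le_deg (Or.inr h1) (Or.inl h2) fun e => ?_
    exact D.asymm _ _ (B.arc_le _ _ h1) (e ▸ B.arc_le _ _ h2)
  by_cases hxc : x ∈ c.support
  · obtain ⟨d, hd, rfl⟩ := exists_dart_snd hc.not_nil hxc
    exact ⟨d.fst, ho d hd, hdeg _ (c.dart_fst_mem_support_of_mem_darts hd)⟩
  · obtain ⟨y, hy, hyx⟩ := hpath x hx hxc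
    obtain ⟨z, hz, hz'⟩ := hyx.exists_arc (by rintro rfl; exact hxc hy)
    refine ⟨z, hz, ?_⟩
    rcases hz' with rfl | h
    · exact hdeg z hy
    · exact h

/-- The vertices of a ⋆-semi-forest lie in a strong vertex cover. -/
theorem IsStarSemiForest.exists_isStrong [Finite V] {H : D.Sub} (hH : H.IsStarSemiForest) :
    ∃ C, D.IsStrong C ∧ H.verts ⊆ C := by
  obtain ⟨r, s, T, v, B, hT, hB, hverts, harc, hTT, hBB, hTB, w, hw, W₁, W₂, hW, -, hind, hplus,
    hW₂, hout⟩ := hH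
  have hdegT : ∀ i, ∀ x ∈ (T i).verts, H.deg x = (T i).deg x := by
    intro i x hx
    have hT' : ∀ i', x ∈ (T i').verts → i' = i := fun i' hx' => by
      by_contra hne
      exact (hTT _ _ hne).le_bot ⟨hx', hx⟩
    have hB' : ∀ j, x ∉ (B j).verts := fun j hx' => (hTB i j).le_bot ⟨hx, hx'⟩
    unfold deg
    congr 1
    ext y
    show (H.arc x y ∨ H.arc y x) ↔ ((T i).arc x y ∨ (T i).arc y x)
    rw [harc, harc]
    constructor
    · rintro ((⟨i', h⟩ | ⟨j, h⟩) | (⟨i', h⟩ | ⟨j, h⟩))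
      · exact Or.inl (hT' i' ((T i').left_mem _ _ h) ▸ h)
      · exact absurd ((B j).left_mem _ _ h) (hB' j)
      · exact Or.inr (hT' i' ((T i').right_mem _ _ h) ▸ h)
      · exact absurd ((B j).right_mem _ _ h) (hB' j)
    · rintro (h | h)
      · exact Or.inl (Or.inl ⟨i, h⟩)
      · exact Or.inr (Or.inl ⟨i, h⟩)
  have hdegB : ∀ j, ∀ x ∈ (B j).verts, H.deg x = (B j).deg x := by
    intro j x hx
    have hB' : ∀ j', x ∈ (B j').verts → j' = j := fun j' hx' => by
      by_contra hne
      exact (hBB _ _ hne).le_bot ⟨hx', hx⟩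
    have hT' : ∀ i, x ∉ (T i).verts := fun i hx' => (hTB i j).le_bot ⟨hx', hx⟩
    unfold deg
    congr 1
    ext y
    show (H.arc x y ∨ H.arc y x) ↔ ((B j).arc x y ∨ (B j).arc y x)
    rw [harc, harc]
    constructor
    · rintro ((⟨i, h⟩ | ⟨j', h⟩) | (⟨i, h⟩ | ⟨j', h⟩))
      · exact absurd ((T i).left_mem _ _ h) (hT' i)
      · exact Or.inl (hB' j' ((B j').left_mem _ _ h) ▸ h)
      · exact absurd ((T i).right_mem _ _ h) (hT' i)
      · exact Or.inr (hB' j' ((B j').right_mem _ _ h) ▸ h)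
    · rintro (h | h)
      · exact Or.inl (Or.inr ⟨j, h⟩)
      · exact Or.inr (Or.inr ⟨j, h⟩)
  -- This gives `H̃ ⊆ V⁺` on the trees: a vertex of weight one is a leaf other than the parent, or
  -- an isolated parent.
  have hTplus : ∀ i, ∀ x ∈ (T i).verts, (2 ≤ (T i).deg x ∨ (x = v i ∧ (T i).deg x = 1)) →
      x ∈ D.plus := by
    intro i x hx hd
    by_contra hx'
    have hx1 : D.weight x = 1 := by
      have := D.weight_pos x
      have : ¬ 1 < D.weight x := hx'
      omega
    rcases (hT i).2.2.2 x hx hx1 with ⟨h1, h2⟩ | ⟨h1, rfl⟩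
    · rcases hd with h | ⟨h, -⟩
      · omega
      · exact h2 h
    · have : (T i).deg (v i) = 0 := by
        rw [deg, Set.ncard_eq_zero (Set.toFinite _), Set.eq_empty_iff_forall_notMem]
        intro y hy
        have hy' : y ∈ (T i).verts :=
          hy.elim (fun h => (T i).right_mem _ _ h) (fun h => (T i).left_mem _ _ h)
        rw [h1] at hy'
        rw [hy'] at hy
        exact (T i).under.irrefl ((SimpleGraph.mem_neighborSet ..).1 hy)
      omega
  -- With `S = W₁` and `A = W₂ ∪ H̃`, every parent is forced into the cover by its `w i`, and every
  -- other vertex by the tail of an arc of `H` entering it.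
  obtain ⟨C, hC, hA, hS, -⟩ := WOGraph.exists_isStrong (D := D) W₁
    (W₂ ∪ ({x | x ∈ H.verts ∧ 2 ≤ H.deg x} ∪ {x | ∃ i, x = v i ∧ H.deg (v i) = 1})) hind
    (by
      rintro x (hx | ⟨hx, hd⟩ | ⟨i, rfl, hd⟩)
      · exact hplus hx
      · rw [hverts] at hx
        rcases hx with hx | hx
        · obtain ⟨i, hi⟩ := Set.mem_iUnion.1 hx
          exact hTplus i x hi (Or.inl (hdegT i x hi ▸ hd))
        · obtain ⟨j, hj⟩ := Set.mem_iUnion.1 hx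
          by_contra hx'
          have hx1 : D.weight x = 1 := by
            have := D.weight_pos x
            have : ¬ 1 < D.weight x := hx'
            omega
          have := (hB j).2 x hj hx1
          rw [hdegB j x hj] at hd
          omega
      · exact hTplus i _ (hT i).1 (Or.inr ⟨rfl, hdegT i _ (hT i).1 ▸ hd⟩))
    hout
  refine ⟨C, hC, fun x hx => ?_⟩
  have hxH := hx
  rw [hverts] at hx
  rcases hx with hx | hx
  · obtain ⟨i, hi⟩ := Set.mem_iUnion.1 hx
    by_cases hxv : x = v i
    · subst hxv
      have hwi : w i ∈ W₁ ∪ W₂ := hW ▸ Set.mem_range_self i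
      rcases hwi with h | h
      · exact hS _ h (mem_nbr_comm.1 (hw i).2)
      · exact hA _ (Or.inl h) (hW₂ i h)
    · obtain ⟨y, hy, hy'⟩ := ((hT i).2.2.1 x hi hxv).exists_arc (Ne.symm hxv)
      have hyT := (T i).left_mem _ _ hy
      refine hA y (Or.inr ?_) ((T i).arc_le _ _ hy)
      by_cases hd : 2 ≤ (T i).deg y
      · exact Or.inl ⟨by rw [hverts]; exact Or.inl (Set.mem_iUnion.2 ⟨i, hyT⟩),
          by rwa [hdegT i y hyT]⟩
      · have hyv := hy'.resolve_right hd
        subst hyv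
        refine Or.inr ⟨i, rfl, ?_⟩
        rw [hdegT i _ hyT]
        have : 0 < (T i).deg (v i) := (Set.ncard_pos (Set.toFinite _)).2 ⟨x, Or.inl hy⟩
        omega
  · obtain ⟨j, hj⟩ := Set.mem_iUnion.1 hx
    obtain ⟨y, hy, hd⟩ := (hB j).exists_arc hj
    have hyB := (B j).left_mem _ _ hy
    exact hA y (Or.inr (Or.inl ⟨by rw [hverts]; exact Or.inr (Set.mem_iUnion.2 ⟨j, hyB⟩),
      by rwa [hdegB j y hyB]⟩)) ((B j).arc_le _ _ hy)

/-! ### Subgraphs in which every vertex has at most one in-neighbour -/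

theorem hasOrientedPath_of_reflTransGen {P : D.Sub} {u x : V} (h : ReflTransGen P.arc u x) :
    P.HasOrientedPath u x := by
  classical
  have hwalk : ∃ p : P.under.Walk u x, P.IsOriented p := by
    induction h using ReflTransGen.head_induction_on with
    | refl => exact ⟨.nil, by simp [IsOriented]⟩
    | @head a b hab _ ih =>
      obtain ⟨p, hp⟩ := ih
      refine ⟨.cons (show P.under.Adj a b from Or.inl hab) p, ?_⟩
      intro d hd
      rw [SimpleGraph.Walk.darts_cons, List.mem_cons] at hd
      rcases hd with rfl | hd
      · exact hab
      · exact hp d hd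
  obtain ⟨p, hp⟩ := hwalk
  exact ⟨p.bypass, p.bypass_isPath, fun d hd => hp d (p.darts_bypass_subset_darts hd)⟩

/-- A cycle has as many edges as vertices. Sending each edge to its head is injective because
in-degrees are at most one, hence bijective: every vertex of the cycle is the head of an edge of it.
-/
theorem exists_arc_mem_edges {P : D.Sub} (hP : ∀ x y y', P.arc y x → P.arc y' x → y = y')
    {u : V} {c : P.under.Walk u u} (hc : c.IsCycle) {x : V} (hx : x ∈ c.support) :
    ∃ y ∈ c.support, P.arc y x ∧ s(y, x) ∈ c.edges := by
  classical
  have hchild : ∀ e ∈ c.edges, ∃ x, ∃ y, P.arc y x ∧ e = s(y, x) ∧ x ∈ c.support.tail := by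
    intro e he
    have hmem : ∀ z ∈ e, z ∈ c.support.tail := by
      intro z hz
      have hz' : z ∈ c.support := c.mem_support_of_mem_edges he hz
      obtain ⟨d, hd, rfl⟩ := exists_dart_snd hc.not_nil hz'
      rw [← SimpleGraph.Walk.map_snd_darts]
      exact List.mem_map_of_mem hd
    have hadj := c.edges_subset_edgeSet he
    induction e with
    | _ a b =>
      rcases hadj with h | h
      · exact ⟨b, a, h, rfl, hmem b (by simp)⟩
      · exact ⟨a, b, h, Sym2.eq_swap, hmem a (by simp)⟩
  have hne : Nonempty V := ⟨u⟩
  choose! f g hf using hchild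
  have hinj : Set.InjOn f (c.edges.toFinset : Set (Sym2 V)) := by
    intro e he e' he' hee
    have h1 := hf e (by simpa using he)
    have h2 := hf e' (by simpa using he')
    have h3 : g e = g e' := hP (f e') _ _ (hee ▸ h1.1) h2.1
    rw [h1.2.1, h2.2.1, hee, h3]
  have himg : c.edges.toFinset.image f = c.support.tail.toFinset := by
    apply Finset.eq_of_subset_of_card_le
    · intro z hz
      obtain ⟨e, he, rfl⟩ := Finset.mem_image.1 hz
      exact List.mem_toFinset.2 (hf e (by simpa using he)).2.2
    · rw [Finset.card_image_of_injOn hinj, List.toFinset_card_of_nodup hc.support_nodup,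
        List.toFinset_card_of_nodup hc.edges_nodup]
      simp
  have hxt : x ∈ c.support.tail.toFinset := by
    obtain ⟨d, hd, rfl⟩ := exists_dart_snd hc.not_nil hx
    rw [List.mem_toFinset, ← SimpleGraph.Walk.map_snd_darts]
    exact List.mem_map_of_mem hd
  rw [← himg, Finset.mem_image] at hxt
  obtain ⟨e, he, rfl⟩ := hxt
  rw [List.mem_toFinset] at he
  have h := hf e he
  have he' : s(g e, f e) ∈ c.edges := h.2.1 ▸ he
  exact ⟨g e, c.fst_mem_support_of_mem_edges he', h.1, he'⟩

/-- The two cycle edges at `x` are distinct, so they cannot both enter `x`. -/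
theorem exists_arc_of_mem_support {P : D.Sub} (hP : ∀ x y y', P.arc y x → P.arc y' x → y = y')
    {u : V} {c : P.under.Walk u u} (hc : c.IsCycle) {x : V} (hx : x ∈ c.support) :
    ∃ y ∈ c.support, P.arc x y := by
  obtain ⟨d, hd, hdx⟩ := exists_dart_snd hc.not_nil hx
  obtain ⟨d', hd', hdx'⟩ := exists_dart_fst hc.not_nil hx
  have hadj : P.under.Adj d.fst d.snd := d.adj
  have hadj' : P.under.Adj d'.fst d'.snd := d'.adj
  rw [hdx] at hadj
  rw [hdx'] at hadj'
  rcases hadj with h | h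
  · rcases hadj' with h' | h'
    · exact ⟨_, c.dart_snd_mem_support_of_mem_darts hd', h'⟩
    · exfalso
      have he := hP _ _ _ h h'
      have hedge : d.edge = d'.edge := by
        rw [SimpleGraph.dart_edge_eq_iff]
        right
        ext
        · simpa using he
        · simp [hdx, hdx']
      have hdd := List.inj_on_of_nodup_map hc.edges_nodup hd hd' hedge
      subst hdd
      exact d.adj.ne (hdx'.trans hdx.symm)
  · exact ⟨_, c.dart_fst_mem_support_of_mem_darts hd, h⟩

theorem mem_support_of_reflTransGen {P : D.Sub}
    (hP : ∀ x y y', P.arc y x → P.arc y' x → y = y') {u : V} {c : P.under.Walk u u}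
    (hc : c.IsCycle) {v x : V} (hvx : ReflTransGen P.arc v x) (hx : x ∈ c.support) :
    v ∈ c.support := by
  induction hvx with
  | refl => exact hx
  | tail _ hbc ih =>
    obtain ⟨y, hy, hyc, -⟩ := exists_arc_mem_edges hP hc hx
    exact ih (hP _ _ _ hyc hbc ▸ hy)

/-- Ancestors of a vertex on an oriented cycle are also its descendants. -/
theorem reflTransGen_symm_of_transGen_self {P : D.Sub}
    (hP : ∀ x y y', P.arc y x → P.arc y' x → y = y') {p y : V} (hp : TransGen P.arc p p)
    (h : ReflTransGen P.arc y p) : ReflTransGen P.arc p y := by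
  induction h using ReflTransGen.head_induction_on with
  | refl => exact .refl
  | @head a b hab _ ih =>
    have hpb : TransGen P.arc p b := by
      rcases reflTransGen_iff_eq_or_transGen.1 ih with rfl | h
      · exact hp
      · exact h
    obtain ⟨z, hz, hzb⟩ := TransGen.tail'_iff.1 hpb
    exact hP _ _ _ hzb hab ▸ hz

/-- The right-hand side does not mention `c`, so all cycles have the same edges. Following
successors along `c` leads to a closed oriented walk; `p` reaches it, and with in-degrees at most
one it leads back to `p`. -/
theorem mem_edges_iff [Finite V] {P : D.Sub} (hP : ∀ x y y', P.arc y x → P.arc y' x → y = y')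
    {p : V} (hv : ∀ x ∈ P.verts, ReflTransGen P.arc p x)
    {u : V} {c : P.under.Walk u u} (hc : c.IsCycle) (e : Sym2 V) :
    e ∈ c.edges ↔ ∃ x y, P.arc y x ∧ ReflTransGen P.arc x p ∧ e = s(y, x) := by
  have hverts : ∀ x ∈ c.support, x ∈ P.verts := fun x hx =>
    let ⟨y, _, h, _⟩ := exists_arc_mem_edges hP hc hx
    P.right_mem _ _ h
  have hpc : p ∈ c.support :=
    mem_support_of_reflTransGen hP hc (hv u (hverts u c.start_mem_support)) c.start_mem_support
  have hup : ∀ x ∈ c.support, ReflTransGen P.arc x p := by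
    intro x hx
    obtain ⟨z, hz, hxz, hzz⟩ :=
      Relation.exists_transGen_self (S := {x | x ∈ c.support})
        (fun x hx => exists_arc_of_mem_support hP hc hx) hx
    exact hxz.trans (reflTransGen_symm_of_transGen_self hP hzz (hv z (hverts z hz)))
  constructor
  · intro he
    have hadj := c.edges_subset_edgeSet he
    induction e with
    | _ a b =>
      rcases hadj with h | h
      · exact ⟨b, a, h, hup b (c.snd_mem_support_of_mem_edges he), rfl⟩
      · exact ⟨a, b, h, hup a (c.fst_mem_support_of_mem_edges he), Sym2.eq_swap⟩
  · rintro ⟨x, y, hyx, hxp, rfl⟩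
    obtain ⟨z, -, hz, he⟩ :=
      exists_arc_mem_edges hP hc (mem_support_of_reflTransGen hP hc hxp hpc)
    exact hP _ _ _ hz hyx ▸ he

/-- An oriented path from `p` to a predecessor `q` of `p` is closed up by the arc `(q, p)`. This
edge is not on the path, which neither re-enters `p` nor uses the reverse arc. -/
theorem exists_isCycle_isOriented {P : D.Sub} {p : V} (hp : TransGen P.arc p p) :
    ∃ (u : V) (c : P.under.Walk u u), c.IsCycle ∧ P.IsOriented c ∧ p ∈ c.support := by
  obtain ⟨q, hpq, hqp⟩ := TransGen.tail'_iff.1 hp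
  obtain ⟨w, hw, ho⟩ := hasOrientedPath_of_reflTransGen hpq
  refine ⟨q, .cons (show P.under.Adj q p from Or.inl hqp) w, ?_, ?_, ?_⟩
  · rw [SimpleGraph.Walk.cons_isCycle_iff]
    refine ⟨hw, fun he => ?_⟩
    obtain ⟨d, hd, hde⟩ := List.mem_map.1 he
    have hdo := ho d hd
    rw [SimpleGraph.Dart.edge, Sym2.eq_iff] at hde
    rcases hde with ⟨h1, h2⟩ | ⟨h1, h2⟩
    · have hp' : p ∈ w.support.tail := by
        rw [← SimpleGraph.Walk.map_snd_darts]
        exact List.mem_map.2 ⟨d, hd, h2⟩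
      have hnd := hw.support_nodup
      rw [← w.cons_tail_support, List.nodup_cons] at hnd
      exact hnd.1 hp'
    · rw [h1, h2] at hdo
      exact D.asymm _ _ (P.arc_le _ _ hdo) (P.arc_le _ _ hqp)
  · intro d hd
    rw [SimpleGraph.Walk.darts_cons, List.mem_cons] at hd
    rcases hd with rfl | hd
    · exact hqp
    · exact ho d hd
  · simp

end Sub

end WOGraph

/-! ### From strong covers to ⋆-semi-forests. -/

namespace WOGraph

variable {V : Type*} {D : WOGraph V}

namespace Sub

/-- The subgraph of the vertices that are reached from `v`. -/
def descendants (H : D.Sub) (v : V) : D.Sub where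
  verts := {x | x ∈ H.verts ∧ ReflTransGen H.arc v x}
  arc x y := H.arc x y ∧ ReflTransGen H.arc v x
  arc_le _ _ h := H.arc_le _ _ h.1
  left_mem _ _ h := ⟨H.left_mem _ _ h.1, h.2⟩
  right_mem _ _ h := ⟨H.right_mem _ _ h.1, h.2.tail h.1⟩

theorem reflTransGen_descendants {H : D.Sub} {v x : V} (h : ReflTransGen H.arc v x) :
    ReflTransGen (H.descendants v).arc v x := by
  induction h with
  | refl => exact .refl
  | tail hb hbc ih => exact ih.tail ⟨hbc, hb⟩

theorem deg_eq_one_of_arc {P : D.Sub} (hP : ∀ x y y', P.arc y x → P.arc y' x → y = y') {x y : V}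
    (hyx : P.arc y x) (hx : ∀ z, ¬ P.arc x z) : P.deg x = 1 := by
  rw [deg, Set.ncard_eq_one]
  refine ⟨y, ?_⟩
  ext z
  constructor
  · rintro (h | h)
    · exact absurd h (hx z)
    · exact hP _ _ _ h hyx
  · rintro rfl
    exact Or.inr hyx

/-- A cycle would contain its ancestor `v`, and hence an arc entering `v`. Vertices of weight one
have no out-arcs, so they are leaves or the lone root. -/
theorem isROT_descendants {H : D.Sub} (hH : ∀ x y y', H.arc y x → H.arc y' x → y = y')
    (hplus : ∀ x y, H.arc x y → x ∈ D.plus) {v : V} (hv : v ∈ H.verts)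
    (hroot : ∀ y, ¬ H.arc y v) : (H.descendants v).IsROT v := by
  have hP : ∀ x y y', (H.descendants v).arc y x → (H.descendants v).arc y' x → y = y' :=
    fun x y y' h h' => hH x y y' h.1 h'.1
  refine ⟨⟨hv, .refl⟩, fun u c hc => ?_, fun x hx _ =>
    hasOrientedPath_of_reflTransGen (reflTransGen_descendants hx.2), fun x hx hw => ?_⟩
  · obtain ⟨y, -, hy, -⟩ := exists_arc_mem_edges hP hc c.start_mem_support
    have hvc := mem_support_of_reflTransGen hP hc
      (reflTransGen_descendants ((H.descendants v).right_mem _ _ hy).2) c.start_mem_support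
    obtain ⟨z, -, hz, -⟩ := exists_arc_mem_edges hP hc hvc
    exact hroot z hz.1
  · have hx' : ∀ z, ¬ H.arc x z := fun z hz => by
      have : 1 < D.weight x := hplus x z hz
      omega
    by_cases hxv : x = v
    · subst hxv
      refine Or.inr ⟨?_, rfl⟩
      ext y
      constructor
      · rintro ⟨-, hy⟩
        rcases ReflTransGen.cases_head hy with h | ⟨z, hz, -⟩
        · exact h.symm
        · exact absurd hz (hx' z)
      · rintro rfl
        exact ⟨hv, .refl⟩
    · rcases ReflTransGen.cases_tail hx.2 with h | ⟨y, hy, hyx⟩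
      · exact absurd h hxv
      · exact Or.inl ⟨deg_eq_one_of_arc hP ⟨hyx, hy⟩ fun z hz => hx' z hz.1, hxv⟩

theorem isUnicycle_descendants [Finite V] {H : D.Sub}
    (hH : ∀ x y y', H.arc y x → H.arc y' x → y = y')
    (hplus : ∀ x y, H.arc x y → x ∈ D.plus) {p : V} (hp : TransGen H.arc p p) :
    (H.descendants p).IsUnicycle := by
  have hP : ∀ x y y', (H.descendants p).arc y x → (H.descendants p).arc y' x → y = y' :=
    fun x y y' h h' => hH x y y' h.1 h'.1
  have hp' : TransGen (H.descendants p).arc p p := by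
    obtain ⟨q, hpq, hqp⟩ := TransGen.tail'_iff.1 hp
    exact TransGen.tail' (reflTransGen_descendants hpq) ⟨hqp, hpq⟩
  have hv : ∀ x ∈ (H.descendants p).verts, ReflTransGen (H.descendants p).arc p x :=
    fun x hx => reflTransGen_descendants hx.2
  obtain ⟨u, c, hc, ho, hpc⟩ := exists_isCycle_isOriented hp'
  refine ⟨⟨u, c, hc, fun u' c' hc' e => ?_, ho, fun y hy _ =>
    ⟨p, hpc, hasOrientedPath_of_reflTransGen (hv y hy)⟩⟩, fun x hx hw => ?_⟩
  · rw [mem_edges_iff hP hv hc, mem_edges_iff hP hv hc']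
  · have hpx : TransGen (H.descendants p).arc p x := by
      rcases reflTransGen_iff_eq_or_transGen.1 (hv x hx) with rfl | h
      · exact hp'
      · exact h
    obtain ⟨y, -, hyx⟩ := TransGen.tail'_iff.1 hpx
    refine deg_eq_one_of_arc hP hyx fun z hz => ?_
    have : 1 < D.weight x := hplus x z hz.1
    omega

/-- Two vertices with a common descendant are comparable. -/
theorem reflTransGen_or_of_reflTransGen {H : D.Sub}
    (hH : ∀ x y y', H.arc y x → H.arc y' x → y = y') {a b x : V}
    (ha : ReflTransGen H.arc a x) (hb : ReflTransGen H.arc b x) :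
    ReflTransGen H.arc a b ∨ ReflTransGen H.arc b a := by
  induction ha with
  | refl => exact Or.inr hb
  | tail hac hcd ih =>
    rcases ReflTransGen.cases_tail hb with rfl | ⟨z, hz, hzd⟩
    · exact Or.inl (hac.tail hcd)
    · exact ih (hH _ _ _ hzd hcd ▸ hz)

/-- Every set of vertices contained in a strong vertex cover has a generating ⋆-semi-forest: each
of its vertices with all neighbours in the cover is joined to an in-neighbour witnessing that the
cover is strong. -/
theorem hasGeneratingStarSemiForest_of_isStrong [Finite V] {C : Set V} (hC : D.IsStrong C)
    {K : D.Sub} (hK : K.verts ⊆ C) : K.HasGeneratingStarSemiForest := by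
  classical
  -- The chosen `y` witnesses strongness if all neighbours of `x` lie in `C`, and is a neighbour
  -- outside `C` otherwise. Only the first kind can give arcs of `H`; both kinds can serve as the `w
  -- i`.
  have hex : ∀ x ∈ C, ∃ y, (D.nbr x ⊆ C → y ∈ D.plus ∧ D.arc y x ∧ D.outNbr y ⊆ C) ∧
      (¬ D.nbr x ⊆ C → y ∈ D.nbr x ∧ y ∉ C) := by
    intro x hx
    by_cases h : D.nbr x ⊆ C
    · obtain ⟨y, h1, h2, h3⟩ := hC.2 x hx h
      exact ⟨y, fun _ => ⟨h1, h2, h3⟩, fun h' => absurd h h'⟩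
    · obtain ⟨y, h1, h2⟩ := Set.not_subset.1 h
      exact ⟨y, fun h' => absurd h' h, fun _ => ⟨h1, h2⟩⟩
  choose! par hpar using hex
  let H : D.Sub :=
    { verts := K.verts
      arc := fun y x => x ∈ K.verts ∧ y ∈ K.verts ∧ D.nbr x ⊆ C ∧ y = par x
      arc_le := fun y x h => h.2.2.2 ▸ ((hpar x (hK h.1)).1 h.2.2.1).2.1
      left_mem := fun _ _ h => h.2.1
      right_mem := fun _ _ h => h.1 }
  have hH : ∀ x y y', H.arc y x → H.arc y' x → y = y' := fun x y y' h h' =>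
    h.2.2.2.trans h'.2.2.2.symm
  have hplus : ∀ x y, H.arc x y → x ∈ D.plus := fun x y h =>
    h.2.2.2 ▸ ((hpar y (hK h.1)).1 h.2.2.1).1
  have hout : ∀ x y, H.arc x y → D.outNbr x ⊆ C := fun x y h =>
    h.2.2.2 ▸ ((hpar y (hK h.1)).1 h.2.2.1).2.2
  let roots : Set V := {v | v ∈ K.verts ∧ ∀ y, ¬ H.arc y v}
  -- Cyclic components are indexed by their vertex sets, because all vertices of one cycle have the
  -- same descendants.
  let comps : Set (Set V) := {S | ∃ p, TransGen H.arc p p ∧ S = (H.descendants p).verts}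
  obtain ⟨r, ⟨er⟩⟩ := Finite.exists_equiv_fin roots
  obtain ⟨s, ⟨es⟩⟩ := Finite.exists_equiv_fin comps
  let v : Fin r → V := fun i => (er.symm i).1
  have hvK : ∀ i, v i ∈ K.verts := fun i => (er.symm i).2.1
  have hvroot : ∀ i y, ¬ H.arc y (v i) := fun i => (er.symm i).2.2
  have hvinj : ∀ i i', v i = v i' → i = i' := fun i i' h =>
    er.symm.injective (Subtype.ext h)
  have hrep : ∀ j : Fin s, ∃ p, TransGen H.arc p p ∧
      (es.symm j).1 = (H.descendants p).verts := fun j => (es.symm j).2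
  choose p hp hpe using hrep
  have hpar_root : ∀ i, D.nbr (v i) ⊆ C → par (v i) ∉ K.verts := fun i h h' =>
    hvroot i _ ⟨hvK i, h', h, rfl⟩
  have hroot_le : ∀ i y, ReflTransGen H.arc y (v i) → y = v i := by
    intro i y h
    rcases ReflTransGen.cases_tail h with h | ⟨z, -, hz⟩
    · exact h.symm
    · exact absurd hz (hvroot i z)
  have hwC : ∀ i, par (v i) ∈ C → D.nbr (v i) ⊆ C := fun i h => by
    by_contra h'
    exact ((hpar _ (hK (hvK i))).2 h').2 h
  have hcov : ∀ x ∈ K.verts, (∃ i, x ∈ (H.descendants (v i)).verts) ∨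
      ∃ j, x ∈ (H.descendants (p j)).verts := by
    intro x hx
    by_cases hroot : ∃ v ∈ roots, ReflTransGen H.arc v x
    · obtain ⟨v', hv', hvx⟩ := hroot
      refine Or.inl ⟨er ⟨v', hv'⟩, hx, ?_⟩
      simpa [v] using hvx
    · push Not at hroot
      -- With no root above `x`, every ancestor of `x` has an in-arc, so going backwards ends in a
      -- cycle.
      obtain ⟨z, -, hxz, hzz⟩ := Relation.exists_transGen_self (R := Function.swap H.arc)
        (S := {y | y ∈ K.verts ∧ ReflTransGen H.arc y x}) (x := x) (by
          rintro y ⟨hy, hyx⟩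
          by_contra! h
          refine hroot y ⟨hy, fun z hz => ?_⟩ hyx
          exact h z ⟨H.left_mem _ _ hz, .head hz hyx⟩ hz) ⟨hx, .refl⟩
      rw [reflTransGen_swap] at hxz
      rw [transGen_swap] at hzz
      refine Or.inr ⟨es ⟨_, z, hzz, rfl⟩, ?_⟩
      rw [← hpe, Equiv.symm_apply_apply]
      exact ⟨hx, hxz⟩
  have hpparent : ∀ j i, p j ≠ v i := by
    intro j i h
    obtain ⟨z, -, hz⟩ := TransGen.tail'_iff.1 (hp j)
    exact hvroot i z (h ▸ hz)
  -- The vertices `w i = par (v i)` are split by membership in `C`: those outside `C` are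
  -- independent, those in `C` witness strongness. A vertex of `H̃` has an out-arc in `H`, so it is
  -- a witness too and its out-neighbours avoid `W₁`.
  refine ⟨H, ⟨r, s, fun i => H.descendants (v i), v, fun j => H.descendants (p j),
    fun i => isROT_descendants hH hplus (hvK i) (hvroot i),
    fun j => isUnicycle_descendants hH hplus (hp j), ?_, ?_, ?_, ?_, ?_,
    fun i => par (v i), ?_, {x | x ∈ Set.range (fun i => par (v i)) ∧ x ∉ C},
    {x | x ∈ Set.range (fun i => par (v i)) ∧ x ∈ C}, ?_, ?_, ?_, ?_, ?_, ?_⟩, rfl⟩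
  · ext x
    simp only [Set.mem_union, Set.mem_iUnion]
    refine ⟨hcov x, ?_⟩
    rintro (⟨i, h⟩ | ⟨j, h⟩) <;> exact h.1
  · intro x y
    constructor
    · intro h
      exact (hcov x (H.left_mem _ _ h)).imp (fun ⟨i, hi⟩ => ⟨i, h, hi.2⟩)
        (fun ⟨j, hj⟩ => ⟨j, h, hj.2⟩)
    · rintro (⟨i, h⟩ | ⟨j, h⟩) <;> exact h.1
  · intro i i' hne
    rw [Set.disjoint_left]
    rintro x ⟨-, hx⟩ ⟨-, hx'⟩
    rcases reflTransGen_or_of_reflTransGen hH hx hx' with h | h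
    · exact hne (hvinj _ _ (hroot_le _ _ h))
    · exact hne (hvinj _ _ (hroot_le _ _ h).symm)
  · intro j j' hne
    rw [Set.disjoint_left]
    rintro x ⟨-, hx⟩ ⟨-, hx'⟩
    have hboth : ReflTransGen H.arc (p j) (p j') ∧ ReflTransGen H.arc (p j') (p j) := by
      rcases reflTransGen_or_of_reflTransGen hH hx hx' with h | h
      · exact ⟨h, reflTransGen_symm_of_transGen_self hH (hp j') h⟩
      · exact ⟨reflTransGen_symm_of_transGen_self hH (hp j) h, h⟩
    refine hne (es.symm.injective (Subtype.ext ?_))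
    rw [hpe, hpe]
    ext y
    exact ⟨fun hy => ⟨hy.1, hboth.2.trans hy.2⟩, fun hy => ⟨hy.1, hboth.1.trans hy.2⟩⟩
  · intro i j
    rw [Set.disjoint_left]
    rintro x ⟨-, hx⟩ ⟨-, hx'⟩
    rcases reflTransGen_or_of_reflTransGen hH hx hx' with h | h
    · exact hpparent j i (hroot_le _ _ (reflTransGen_symm_of_transGen_self hH (hp j) h))
    · exact hpparent j i (hroot_le _ _ h)
  · intro i
    by_cases h : D.nbr (v i) ⊆ C
    · exact ⟨hpar_root i h, Or.inr ((hpar _ (hK (hvK i))).1 h).2.1⟩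
    · have := (hpar _ (hK (hvK i))).2 h
      exact ⟨fun h' => this.2 (hK h'), this.1⟩
  · ext x
    simp only [Set.mem_union, Set.mem_ofPred_eq]
    tauto
  · rw [Set.disjoint_left]
    rintro x ⟨-, h⟩ ⟨-, h'⟩
    exact h h'
  · rintro x ⟨-, hx⟩ y ⟨-, hy⟩ - hxy
    exact hy (hC.1.nbr_subset hx (mem_nbr.2 hxy))
  · rintro _ ⟨⟨i, rfl⟩, hx⟩
    exact ((hpar _ (hK (hvK i))).1 (hwC i hx)).1
  · rintro i ⟨-, hx⟩
    exact ((hpar _ (hK (hvK i))).1 (hwC i hx)).2.1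
  · have hdisj : ∀ x, D.outNbr x ⊆ C →
        Disjoint (D.outNbr x) {x | x ∈ Set.range (fun i => par (v i)) ∧ x ∉ C} := by
      intro x hx
      rw [Set.disjoint_left]
      rintro y hy ⟨-, hyC⟩
      exact hyC (hx hy)
    rintro x (⟨⟨i, rfl⟩, hx⟩ | ⟨-, hd⟩ | ⟨i, rfl, hd⟩)
    · exact hdisj _ ((hpar _ (hK (hvK i))).1 (hwC i hx)).2.2
    · obtain ⟨a, b, ha, hb, hab⟩ := (Set.one_lt_ncard_iff (Set.toFinite _)).1 hd
      rcases ha with ha | ha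
      · exact hdisj _ (hout _ _ ha)
      · rcases hb with hb | hb
        · exact hdisj _ (hout _ _ hb)
        · exact absurd (hH _ _ _ ha hb) hab
    · obtain ⟨a, ha⟩ := Set.ncard_eq_one.1 hd
      have ha' : a ∈ H.under.neighborSet (v i) := ha ▸ rfl
      rcases ha' with h | h
      · exact hdisj _ (hout _ _ h)
      · exact absurd h (hvroot i a)

end Sub

end WOGraph

/-! ### Counting missed vertices on the parts of the SCQ partition. -/

namespace WOGraph

variable {V : Type*} {D : WOGraph V}

theorem ncard_compl_inter_clique [Finite V] {A C : Set V} (hA : D.graph.IsClique A)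
    (hC : D.IsCover C) : (Cᶜ ∩ A).ncard ≤ 1 ∧ ((Cᶜ ∩ A).ncard = 1 ↔ ¬ A ⊆ C) := by
  have hle : (Cᶜ ∩ A).ncard ≤ 1 := by
    rw [Set.ncard_le_one (Set.toFinite _)]
    rintro x ⟨hx, hxA⟩ y ⟨hy, hyA⟩
    by_contra hne
    exact hy (hC.nbr_subset hx (mem_nbr.2 (hA hxA hyA hne)))
  refine ⟨hle, fun h hAC => ?_, fun h => ?_⟩
  · rw [Set.ncard_eq_one] at h
    obtain ⟨x, hx⟩ := h
    have : x ∈ Cᶜ ∩ A := hx ▸ rfl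
    exact this.1 (hAC this.2)
  · obtain ⟨x, hxA, hxC⟩ := Set.not_subset.1 h
    have := (Set.ncard_pos (Set.toFinite (Cᶜ ∩ A))).2 ⟨x, hxC, hxA⟩
    omega

/-- The missed vertices are pairwise non-adjacent, so there are at most two on a 5-cycle. When at
most one is missed, the other four are consecutive. -/
theorem IsFiveCycle.ncard_compl_inter [Finite V] {A C : Set V} {p q r s t : V}
    (h : D.IsFiveCycle A p q r s t) (hC : D.IsCover C) :
    (Cᶜ ∩ A).ncard ≤ 2 ∧ ((Cᶜ ∩ A).ncard = 2 ↔
      ∀ p q r s t, D.IsFiveCycle A p q r s t → ¬ (p ∈ C ∧ q ∈ C ∧ r ∈ C ∧ s ∈ C)) := by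
  have hpair : ∀ x y, Cᶜ ∩ A ⊆ {x, y} → (Cᶜ ∩ A).ncard ≤ 2 := fun x y hxy =>
    (Set.ncard_le_ncard hxy (Set.toFinite _)).trans
      ((Set.ncard_insert_le _ _).trans (by rw [Set.ncard_singleton]))
  have hcov : ∀ x y, D.graph.Adj x y → x ∈ C ∨ y ∈ C := by
    intro x y hxy
    by_contra! h
    exact h.2 (hC.nbr_subset h.1 (mem_nbr.2 hxy))
  have hle : (Cᶜ ∩ A).ncard ≤ 2 := by
    have hsub : ∀ x y, (∀ z ∈ ({p, q, r, s, t} : Set V), z ∉ C → z = x ∨ z = y) →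
        (Cᶜ ∩ A).ncard ≤ 2 := by
      intro x y hz
      refine hpair x y fun z hz' => hz z (h.eq ▸ hz'.2) hz'.1
    have c1 := hcov _ _ h.adj.1
    have c2 := hcov _ _ h.adj.2.1
    have c3 := hcov _ _ h.adj.2.2.1
    have c4 := hcov _ _ h.adj.2.2.2.1
    have c5 := hcov _ _ h.adj.2.2.2.2
    simp only [Set.mem_insert_iff, Set.mem_singleton_iff, forall_eq_or_imp, forall_eq] at hsub
    by_cases hp : p ∈ C
    · by_cases hq : q ∈ C
      · by_cases hs : s ∈ C
        · exact hsub r t (by tauto)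
        · exact hsub s s (by tauto)
      · by_cases hs : s ∈ C
        · exact hsub q t (by tauto)
        · exact hsub q s (by tauto)
    · by_cases hs : s ∈ C
      · exact hsub p r (by tauto)
      · exact hsub p s (by tauto)
  refine ⟨hle, fun h2 p q r s t h ⟨hp, hq, hr, hs⟩ => ?_, fun h4 => ?_⟩
  · have hsub : Cᶜ ∩ A ⊆ {t} := by
      rintro x ⟨hx, hxA⟩
      rw [h.eq] at hxA
      rcases hxA with rfl | rfl | rfl | rfl | rfl
      · exact absurd hp hx
      · exact absurd hq hx
      · exact absurd hr hx
      · exact absurd hs hx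
      · rfl
    have := Set.ncard_le_ncard hsub (Set.toFinite _)
    rw [Set.ncard_singleton] at this
    omega
  · by_contra hne
    have h1 : (Cᶜ ∩ A).ncard ≤ 1 := by omega
    rw [Set.ncard_le_one (Set.toFinite _)] at h1
    have hmem : ∀ x ∈ A, x ∉ C → ∀ y ∈ A, x ≠ y → y ∈ C := by
      intro x hx hxC y hy hxy
      by_contra hyC
      exact hxy (h1 x ⟨hxC, hx⟩ y ⟨hyC, hy⟩)
    have key : ∀ p q r s t, D.IsFiveCycle A p q r s t → p ∈ C := by
      intro p q r s t h
      by_contra hp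
      obtain ⟨n1, n2, n3, n4⟩ := h.ne
      have hA := h.eq
      exact h4 q r s t p h.rotate ⟨hmem p (by simp [hA]) hp q (by simp [hA]) n1,
        hmem p (by simp [hA]) hp r (by simp [hA]) n2,
        hmem p (by simp [hA]) hp s (by simp [hA]) n3,
        hmem p (by simp [hA]) hp t (by simp [hA]) n4⟩
    exact h4 p q r s t h ⟨key _ _ _ _ _ h, key _ _ _ _ _ h.rotate, key _ _ _ _ _ h.rotate.rotate,
      key _ _ _ _ _ h.rotate.rotate.rotate⟩

theorem isClique_edge {b b' : V} (h : D.graph.Adj b b') :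
    D.graph.IsClique {x | x ∈ s(b, b')} := by
  intro x hx y hy hne
  rcases Sym2.mem_iff.1 hx with rfl | rfl <;> rcases Sym2.mem_iff.1 hy with rfl | rfl
  · exact absurd rfl hne
  · exact h
  · exact h.symm
  · exact absurd rfl hne

theorem edge_subset_iff {b b' : V} {C : Set V} :
    {x | x ∈ s(b, b')} ⊆ C ↔ b ∈ C ∧ b' ∈ C := by
  constructor
  · intro h
    exact ⟨h (Sym2.mem_mk_left b b'), h (Sym2.mem_mk_right b b')⟩
  · rintro ⟨h, h'⟩ x hx
    rcases Sym2.mem_iff.1 hx with rfl | rfl <;> assumption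

/-- Vertex sets with traces of comparable size on the parts of a partition have the same size if
and only if all the traces have. -/
theorem ncard_eq_iff_of_isPartition [Finite V] {P : Set (Set V)} (hP : Setoid.IsPartition P)
    {C C' : Set V} (hle : ∀ A ∈ P, (Cᶜ ∩ A).ncard ≤ (C'ᶜ ∩ A).ncard) :
    C.ncard = C'.ncard ↔ ∀ A ∈ P, (Cᶜ ∩ A).ncard = (C'ᶜ ∩ A).ncard := by
  classical
  have : Fintype P := Fintype.ofFinite _
  have h1 := Set.ncard_add_ncard_compl C
  have h2 := Set.ncard_add_ncard_compl C'
  have h3 := hP.ncard_eq_finsum Cᶜ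
  have h4 := hP.ncard_eq_finsum C'ᶜ
  rw [finsum_eq_sum_of_fintype] at h3 h4
  have h5 := Finset.sum_eq_sum_iff_of_le (s := Finset.univ)
    (f := fun A : P => (Cᶜ ∩ A.1).ncard) (g := fun A : P => (C'ᶜ ∩ A.1).ncard)
    (fun A _ => hle A.1 A.2)
  rw [← h3, ← h4] at h5
  have h6 : C.ncard = C'.ncard ↔ Cᶜ.ncard = C'ᶜ.ncard := by omega
  rw [h6, h5]
  exact ⟨fun h A hA => h ⟨A, hA⟩ (Finset.mem_univ _), fun h A _ => h A.1 A.2⟩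

/-- A minimal vertex cover of an SCQ graph meets every part of the partition in as few vertices as
any vertex cover can. -/
theorem ncard_compl_inter_of_minimal [Finite V] {Q : Set (Sym2 V)} (hQ : SCQ.IsSCQ D.graph Q)
    {C₀ : Set V} (h₀ : D.IsCover C₀) (hmin : ∀ x ∈ C₀, ¬ D.nbr x ⊆ C₀) :
    (∀ A ∈ SCQ.simplexes D.graph, (C₀ᶜ ∩ A).ncard = 1) ∧
      (∀ A ∈ SCQ.basicFiveCycles D.graph, (C₀ᶜ ∩ A).ncard = 2) ∧
      (∀ e ∈ Q, (C₀ᶜ ∩ {x | x ∈ e}).ncard = 1) := by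
  refine ⟨?_, fun A hA => ?_, fun e he => ?_⟩
  · rintro A ⟨v, rfl, hcl⟩
    refine (ncard_compl_inter_clique hcl h₀).2.2 fun hsub => ?_
    exact hmin v (hsub (Or.inl rfl)) fun x hx => hsub (Or.inr (mem_nbr.1 hx))
  · obtain ⟨⟨p, q, r, s, t, h⟩, hbasic⟩ := exists_isFiveCycle_of_mem_basicFiveCycles hA
    refine (h.ncard_compl_inter h₀).2.2 ?_
    rintro p q r s t h ⟨hp, hq, hr, hs⟩
    rcases hbasic _ _ _ _ _ h.rotate with h1 | h1
    · refine hmin q hq fun x hx => ?_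
      rcases h.nbr_inter hx (h1 hx) with rfl | rfl <;> assumption
    · refine hmin r hr fun x hx => ?_
      rcases h.rotate.nbr_inter hx (h1 hx) with rfl | rfl <;> assumption
  · induction e with
    | _ b b' =>
      refine (ncard_compl_inter_clique (isClique_edge (hQ.matching.1 he)) h₀).2.2 ?_
      rw [edge_subset_iff]
      rintro ⟨hb, hb'⟩
      rcases nbr_subset_of_propertyP (hQ.propertyP _ he) h₀ with h | h
      · exact hmin b hb h
      · exact hmin b' hb' h

/-- Every strong cover is compared with one strong cover `C₀` that misses as many vertices as
possible on each part. Equality of sizes then means equality on each part. -/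
theorem isUnmixed_edgeIdeal_iff_of_isSCQ [Finite V] (K : Type*) [Field K] {Q : Set (Sym2 V)}
    (hQ : SCQ.IsSCQ D.graph Q) :
    IdealIsUnmixed (D.edgeIdeal K) ↔ ∀ C, D.IsStrong C →
      (∀ A ∈ SCQ.basicFiveCycles D.graph, ∀ p q r s t, D.IsFiveCycle A p q r s t →
        ¬ (p ∈ C ∧ q ∈ C ∧ r ∈ C ∧ s ∈ C)) ∧
      (∀ A ∈ SCQ.simplexes D.graph, ¬ A ⊆ C) ∧
      (∀ b b', s(b, b') ∈ Q → ¬ (b ∈ C ∧ b' ∈ C)) := by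
  -- With `S` and `A` empty, no vertex of the cover has all its neighbours in it, so `C₀` is a
  -- minimal vertex cover.
  obtain ⟨C₀, hC₀, -, -, hmin⟩ := exists_isStrong (D := D) ∅ ∅ (by simp) (by simp) (by simp)
  replace hmin : ∀ x ∈ C₀, ¬ D.nbr x ⊆ C₀ := fun x hx h => by simpa using hmin x hx h
  obtain ⟨hS, hF, hE⟩ := ncard_compl_inter_of_minimal hQ hC₀.1 hmin
  have hblock : ∀ C, D.IsCover C → (C.ncard = C₀.ncard ↔
      (∀ A ∈ SCQ.basicFiveCycles D.graph, ∀ p q r s t, D.IsFiveCycle A p q r s t →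
        ¬ (p ∈ C ∧ q ∈ C ∧ r ∈ C ∧ s ∈ C)) ∧
      (∀ A ∈ SCQ.simplexes D.graph, ¬ A ⊆ C) ∧
      (∀ b b', s(b, b') ∈ Q → ¬ (b ∈ C ∧ b' ∈ C))) := by
    intro C hC
    have hS' : ∀ A ∈ SCQ.simplexes D.graph, _ := fun A hA =>
      let ⟨_, _, hcl⟩ := hA
      ncard_compl_inter_clique hcl hC
    have hF' : ∀ A ∈ SCQ.basicFiveCycles D.graph, _ := fun A hA =>
      let ⟨⟨_, _, _, _, _, h⟩, _⟩ := exists_isFiveCycle_of_mem_basicFiveCycles hA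
      h.ncard_compl_inter hC
    have hE' : ∀ b b', s(b, b') ∈ Q → _ := fun b b' he =>
      ncard_compl_inter_clique (isClique_edge (hQ.matching.1 he)) hC
    rw [ncard_eq_iff_of_isPartition hQ.partition]
    · constructor
      · intro h
        refine ⟨fun A hA => (hF' A hA).2.1 ?_, fun A hA => (hS' A hA).2.1 ?_, fun b b' he => ?_⟩
        · rw [h A (Or.inl (Or.inr hA)), hF A hA]
        · rw [h A (Or.inl (Or.inl hA)), hS A hA]
        · rw [← edge_subset_iff]
          refine (hE' b b' he).2.1 ?_
          rw [h _ (Or.inr ⟨_, he, rfl⟩), hE _ he]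
      · rintro ⟨h1, h2, h3⟩ A ((hA | hA) | ⟨e, he, rfl⟩)
        · rw [hS A hA, (hS' A hA).2.2 (h2 A hA)]
        · rw [hF A hA, (hF' A hA).2.2 (h1 A hA)]
        · rw [hE e he]
          induction e with
          | _ b b' => exact (hE' b b' he).2.2 (by rw [edge_subset_iff]; exact h3 b b' he)
    · rintro A ((hA | hA) | ⟨e, he, rfl⟩)
      · rw [hS A hA]
        exact (hS' A hA).1
      · rw [hF A hA]
        exact (hF' A hA).1
      · rw [hE e he]
        induction e with
        | _ b b' => exact (hE' b b' he).1
  rw [isUnmixed_edgeIdeal_iff]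
  constructor
  · exact fun h C hC => (hblock C hC.1).1 (h C C₀ hC hC₀)
  · intro h C C' hC hC'
    rw [(hblock C hC.1).2 (h C hC), (hblock C' hC'.1).2 (h C' hC')]

end WOGraph

/-! ### The three exclusions matched with (a), (b) and (c). -/

theorem mainTheorem1 {V : Type*} [Finite V] (K : Type*) [Field K] (D : WOGraph V)
    (hsource : ∀ x, D.IsSource x → D.weight x = 1)
    (Q : Set (Sym2 V)) (hQ : SCQ.IsSCQ D.graph Q) :
    IdealIsUnmixed (D.edgeIdeal K) ↔
      (∀ C ∈ SCQ.basicFiveCycles D.graph, D.HasStarProperty C) ∧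
      (∀ A ∈ SCQ.simplexes D.graph, ¬ (D.induce A).HasGeneratingStarSemiForest) ∧
      (∀ a b b' : V, a ∈ D.plus → s(b, b') ∈ Q → b' ∈ D.outNbr a →
        D.nbr b ⊆ D.outNbr a) := by
  rw [WOGraph.isUnmixed_edgeIdeal_iff_of_isSCQ K hQ]
  constructor
  · intro h
    refine ⟨fun A hA => ?_, fun A hA => ?_, fun a b b' ha he hab => ?_⟩
    · exact WOGraph.hasStarProperty_of_forall_isStrong hsource fun C hC => (h C hC).1 A hA
    · rintro ⟨H, hH, hAH⟩
      obtain ⟨C, hC, hHC⟩ := hH.exists_isStrong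
      exact (h C hC).2.1 A hA (show (D.induce A).verts ⊆ C from hAH ▸ hHC)
    · exact WOGraph.outNbr_of_edge (fun C hC => (h C hC).2.2 b b' he) ha hab
  · rintro ⟨h1, h2, h3⟩ C hC
    refine ⟨fun A hA p q r s t hc => ?_, fun A hA hAC => ?_, fun b b' he => ?_⟩
    · rintro ⟨hp, hq, hr, hs⟩
      exact hC.not_four_mem hc
        (WOGraph.exists_isFiveCycle_of_mem_basicFiveCycles hA).2 (h1 A hA) hp hq hr hs
    · exact h2 A hA (WOGraph.Sub.hasGeneratingStarSemiForest_of_isStrong hC hAC)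
    · exact hC.not_both_mem_of_edge (hQ.propertyP _ he) (fun a ha hab => h3 a b b' ha he hab)
        (fun a ha hab => h3 a b' b ha (Sym2.eq_swap ▸ he) hab)
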